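/- For a group $G$ generated by a finite set $S$, let $\ell_{G,S}(g)$ be the least $n$ such that $g$ is a product of $n$ elements of $S\cup S^{-1}$, let $F_{G,S}(n)=\#\{g\in G:\ell_{G,S}(g)\le n\}$, and let $\omega(G,S)=\lim_{n\to\infty}F_{G,S}(n)^{1/n}$ (this limit always exists). For a finitely generated group $G$ let $\Omega(G)=\inf_S\omega(G,S)$, the infimum being over all finite generating sets $S$ of $G$. Write $C_k$ for the cyclic group of order $k$. Let $G=A*B$ be a finitely generated free product of two nontrivial groups $A$ and $B$. If $G$ is isomorphic neither to $C_2*C_2$ nor to $C_2*C_3$, then $$\Omega(G)\ \ge\ \frac{1+\sqrt5}{2}.$$ Moreover, there is no finitely generated free product $G=A*B$ of two nontrivial groups (the cases $C_2*C_2$ and $C_2*C_3$ included) with $\sqrt2<\Omega(G)<\frac{1+\sqrt5}{2}$. -/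

import Mathlib

open Filter Topology

/-- The natural numbers `n` such that `g` is a product of `n` factors from `S ∪ S⁻¹`. -/
def wordLengths {G : Type*} [Group G] (S : Finset G) (g : G) : Set ℕ :=
  {n | ∃ l : List G, l.length = n ∧ (∀ x ∈ l, x ∈ S ∨ x⁻¹ ∈ S) ∧ l.prod = g}

/-- The length of `g` with respect to `S`: the least `n` such that `g` is a product of `n`
factors from `S ∪ S⁻¹`. Used for generating sets `S` only, where such an `n` exists. -/
noncomputable def wordLength {G : Type*} [Group G] (S : Finset G) (g : G) : ℕ :=
  sInf (wordLengths S g)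

/-- The growth function: the number of elements of length at most `n`. -/
noncomputable def growthFunction {G : Type*} [Group G] (S : Finset G) (n : ℕ) : ℕ :=
  Set.ncard {g : G | wordLength S g ≤ n}

/-- The exponential growth rate `ω(G, S)`, the limit of the `n`-th roots of the growth function.
The limit exists for every finite generating set: see `tendsto_expGrowthRate`. -/
noncomputable def expGrowthRate {G : Type*} [Group G] (S : Finset G) : ℝ :=
  limUnder atTop (fun n : ℕ => (growthFunction S n : ℝ) ^ (1 / (n : ℝ)))

/-- The minimal exponential growth rate `Ω(G)`, the infimum of `ω(G, S)` over all finite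
generating sets `S` of `G`. -/
noncomputable def minExpGrowthRate (G : Type*) [Group G] : ℝ :=
  sInf {r : ℝ | ∃ S : Finset G, Subgroup.closure (S : Set G) = ⊤ ∧ r = expGrowthRate S}

theorem wordLengths_nonempty {G : Type*} [Group G] {S : Finset G}
    (hS : Subgroup.closure (S : Set G) = ⊤) (g : G) : (wordLengths S g).Nonempty := by
  have hg : g ∈ (Subgroup.closure (S : Set G)).toSubmonoid := by rw [hS]; trivial
  rw [Subgroup.closure_toSubmonoid] at hg
  obtain ⟨l, hl, hp⟩ := Submonoid.exists_list_of_mem_closure hg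
  exact ⟨l.length, l, rfl, fun x hx => by simpa using hl x hx, hp⟩

theorem exists_list_wordLength {G : Type*} [Group G] {S : Finset G}
    (hS : Subgroup.closure (S : Set G) = ⊤) (g : G) :
    ∃ l : List G, l.length = wordLength S g ∧ (∀ x ∈ l, x ∈ S ∨ x⁻¹ ∈ S) ∧ l.prod = g :=
  Nat.sInf_mem (wordLengths_nonempty hS g)

theorem wordLength_prod_le {G : Type*} [Group G] {S : Finset G} (l : List G)
    (hl : ∀ x ∈ l, x ∈ S ∨ x⁻¹ ∈ S) : wordLength S l.prod ≤ l.length :=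
  Nat.sInf_le ⟨l, rfl, hl, rfl⟩

open scoped Pointwise in
theorem wordBall_subset_mul {G : Type*} [Group G] {S : Finset G}
    (hS : Subgroup.closure (S : Set G) = ⊤) (m n : ℕ) :
    {g : G | wordLength S g ≤ m + n} ⊆
      {g : G | wordLength S g ≤ m} * {g : G | wordLength S g ≤ n} := by
  intro g hg
  obtain ⟨l, hlen, hl, hp⟩ := exists_list_wordLength hS g
  have hg' : wordLength S g ≤ m + n := hg
  refine Set.mem_mul.2 ⟨(l.take m).prod, ?_, (l.drop m).prod, ?_, ?_⟩
  · refine (wordLength_prod_le _ fun x hx => hl x (List.mem_of_mem_take hx)).trans ?_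
    simp
  · refine (wordLength_prod_le _ fun x hx => hl x (List.mem_of_mem_drop hx)).trans ?_
    simp only [List.length_drop]
    omega
  · rw [List.prod_take_mul_prod_drop, hp]

theorem wordBall_finite {G : Type*} [Group G] {S : Finset G}
    (hS : Subgroup.closure (S : Set G) = ⊤) (n : ℕ) :
    {g : G | wordLength S g ≤ n}.Finite := by
  induction n with
  | zero =>
    refine (Set.finite_singleton (1 : G)).subset fun g hg => ?_
    obtain ⟨l, hlen, -, hp⟩ := exists_list_wordLength hS g
    have h0 : l.length = 0 := by rw [hlen]; exact Nat.le_zero.1 hg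
    rw [List.length_eq_zero_iff.1 h0] at hp
    simpa using hp.symm
  | succ n ih =>
    refine (ih.mul (?_ : {g : G | wordLength S g ≤ 1}.Finite)).subset (wordBall_subset_mul hS n 1)
    have hfin : ((S : Set G) ∪ (S : Set G)⁻¹ ∪ {1}).Finite :=
      (S.finite_toSet.union S.finite_toSet.inv).union (Set.finite_singleton 1)
    refine hfin.subset fun g hg => ?_
    obtain ⟨l, hlen, hl, hp⟩ := exists_list_wordLength hS g
    have h1 : l.length ≤ 1 := by rw [hlen]; exact hg
    match l, h1, hl, hp with
    | [], _, _, hp => right; simpa using hp.symm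
    | [x], _, hl, hp =>
      left
      have hx : x = g := by simpa using hp
      simpa [hx] using hl x (by simp)

theorem one_le_growthFunction {G : Type*} [Group G] {S : Finset G}
    (hS : Subgroup.closure (S : Set G) = ⊤) (n : ℕ) : 1 ≤ growthFunction S n := by
  refine (Set.ncard_pos (wordBall_finite hS n)).2 ⟨1, ?_⟩
  exact (wordLength_prod_le (S := S) ([] : List G) (by simp)).trans (Nat.zero_le n)

theorem growthFunction_add_le {G : Type*} [Group G] {S : Finset G}
    (hS : Subgroup.closure (S : Set G) = ⊤) (m n : ℕ) :
    growthFunction S (m + n) ≤ growthFunction S m * growthFunction S n := by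
  refine (Set.ncard_le_ncard (wordBall_subset_mul hS m n)
    ((wordBall_finite hS m).mul (wordBall_finite hS n))).trans ?_
  rw [growthFunction, growthFunction, ← Set.ncard_prod, ← Set.image_mul_prod]
  exact Set.ncard_image_le ((wordBall_finite hS m).prod (wordBall_finite hS n))

/-- The limit that defines the exponential growth rate exists. -/
theorem tendsto_expGrowthRate {G : Type*} [Group G] {S : Finset G}
    (hS : Subgroup.closure (S : Set G) = ⊤) :
    Tendsto (fun n : ℕ => (growthFunction S n : ℝ) ^ (1 / (n : ℝ))) atTop
      (𝓝 (expGrowthRate S)) := by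
  have hone : ∀ n, (1 : ℝ) ≤ growthFunction S n := fun n => by
    exact_mod_cast one_le_growthFunction hS n
  have hpos : ∀ n, (0 : ℝ) < growthFunction S n := fun n => one_pos.trans_le (hone n)
  have hsub : Subadditive (fun n => Real.log (growthFunction S n)) := by
    intro m n
    rw [← Real.log_mul (hpos m).ne' (hpos n).ne']
    exact Real.log_le_log (hpos _) (by exact_mod_cast growthFunction_add_le hS m n)
  have hbdd : BddBelow (Set.range fun n : ℕ => Real.log (growthFunction S n) / n) := by
    refine ⟨0, ?_⟩
    rintro _ ⟨n, rfl⟩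
    exact div_nonneg (Real.log_nonneg (hone n)) n.cast_nonneg
  refine tendsto_nhds_limUnder ⟨Real.exp hsub.lim, ?_⟩
  refine ((Real.continuous_exp.tendsto _).comp (hsub.tendsto_lim hbdd)).congr fun n => ?_
  simp only [Function.comp_apply]
  rw [Real.rpow_def_of_pos (hpos n), mul_one_div]

/-! Let G = A * B act on its Bass–Serre tree. Edge stabilizers are trivial, so the unoriented edges
are the elements of G, and the geometry can be read off normal forms: the factor of the first
syllable of x⁻¹y tells beyond which end of the edge x the edge y lies. `FreeSplitting` records the
facts about syllables that this needs; oriented edges become a partial order, and ping-pong is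
played on the half-trees `half e`.

Lower bounds come from two counting devices. Three elements of word lengths 2, 2, 3 that map a set
into itself with disjoint images give growth x³ = 2x + 1 (`goldenRatio_le_of_three_maps`). An
automaton with two states, each with one transition of one letter and one of two letters, gives x² =
x + 1 (`goldenRatio_le_of_two_states`). The golden ratio is the positive root of both equations.

Fix a finite generating set. If a letter h is hyperbolic and a letter s moves its axis, then h and
shs⁻¹ generate a free monoid up to inverting them, which the automaton counts. If every letter
preserves the axis, the tree is a line, because G is transitive on unoriented edges, and both
factors have order two.

Otherwise every nontrivial letter fixes a vertex. Too many elements in one vertex group, or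
non-involutions at two vertices, yield three maps. So do letters at three vertices that span a
tripod. If the second of three vertices lies between the others, the products xy and y⁻¹z of the
letters there are hyperbolic; they play ping-pong, counted by the automaton because y cancels, or
they share an axis. Sharing is impossible if exactly one of the letters is not an involution, and if
all letters are involutions it forces the tree to be a line. What survives is a generating pair of
orders two and three playing ping-pong, so G is C₂ * C₃.

For the gap, the standard generators of the two exceptional groups have growth rate at most √2,
since alternating words at most double in number every two letters. -/

/-- `s` is a generator or the inverse of a generator. -/
def IsLetter {G : Type*} [Group G] (S : Finset G) (s : G) : Prop := s ∈ S ∨ s⁻¹ ∈ S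

theorem IsLetter.inv {G : Type*} [Group G] {S : Finset G} {s : G} (h : IsLetter S s) :
    IsLetter S s⁻¹ := by
  rcases h with h | h
  · exact Or.inr (by simpa using h)
  · exact Or.inl h

/-! ### Word length and growth rate -/

section Length

variable {G : Type*} [Group G] {S : Finset G}

theorem wordLength_mul_le (hS : Subgroup.closure (S : Set G) = ⊤) (g h : G) :
    wordLength S (g * h) ≤ wordLength S g + wordLength S h := by
  obtain ⟨l, hlen, hl, rfl⟩ := exists_list_wordLength hS g
  obtain ⟨m, hlen', hm, rfl⟩ := exists_list_wordLength hS h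
  rw [← hlen, ← hlen', ← List.prod_append, ← List.length_append]
  refine wordLength_prod_le _ fun x hx => ?_
  rcases List.mem_append.1 hx with hx | hx
  · exact hl x hx
  · exact hm x hx

theorem IsLetter.wordLength_le {s : G} (h : IsLetter S s) : wordLength S s ≤ 1 := by
  simpa using wordLength_prod_le (S := S) [s] (by simpa [IsLetter] using h)

theorem IsLetter.wordLength_mul_le {s t : G} (hs : IsLetter S s) (ht : IsLetter S t) :
    wordLength S (s * t) ≤ 2 := by
  simpa using wordLength_prod_le (S := S) [s, t] (by simpa [IsLetter] using ⟨hs, ht⟩)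

theorem IsLetter.wordLength_mul_mul_le {s t u : G} (hs : IsLetter S s) (ht : IsLetter S t)
    (hu : IsLetter S u) : wordLength S (s * t * u) ≤ 3 := by
  simpa [mul_assoc] using
    wordLength_prod_le (S := S) [s, t, u] (by simpa [IsLetter] using ⟨hs, ht, hu⟩)

/-- The constant disappears because its n-th root tends to 1. -/
theorem le_expGrowthRate_of_forall_le (hS : Subgroup.closure (S : Set G) = ⊤) {c ρ : ℝ}
    (hc : 0 < c) (hρ : 0 < ρ) (h : ∀ n, c * ρ ^ n ≤ growthFunction S n) :
    ρ ≤ expGrowthRate S := by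
  have h1 : Tendsto (fun n : ℕ => c ^ (1 / (n : ℝ)) * ρ) atTop (𝓝 ρ) := by
    have h0 : Tendsto (fun n : ℕ => c ^ (1 / (n : ℝ))) atTop (𝓝 (c ^ (0 : ℝ))) :=
      tendsto_const_nhds.rpow tendsto_one_div_atTop_nhds_zero_nat (Or.inl hc.ne')
    simpa using h0.mul_const ρ
  refine le_of_tendsto_of_tendsto h1 (tendsto_expGrowthRate hS) ?_
  filter_upwards [eventually_gt_atTop 0] with n hn
  have hn' : (n : ℝ) ≠ 0 := by exact_mod_cast hn.ne'
  calc c ^ (1 / (n : ℝ)) * ρ = (c * ρ ^ n) ^ (1 / (n : ℝ)) := by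
        rw [Real.mul_rpow hc.le (by positivity), ← Real.rpow_natCast, ← Real.rpow_mul hρ.le,
          mul_one_div_cancel hn', Real.rpow_one]
    _ ≤ _ := Real.rpow_le_rpow (by positivity) (h n) (by positivity)

/-- A family of finite sets `T n` of elements of length at most `n + k` bounds the growth rate. -/
theorem goldenRatio_le_expGrowthRate_of_finset (hS : Subgroup.closure (S : Set G) = ⊤)
    (T : ℕ → Finset G) (k : ℕ) (hlen : ∀ n, ∀ g ∈ T n, wordLength S g ≤ n + k)
    {c : ℝ} (hc : 0 < c) (hcard : ∀ n, c * Real.goldenRatio ^ n ≤ (T n).card) :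
    Real.goldenRatio ≤ expGrowthRate S := by
  have hpos := Real.goldenRatio_pos
  have hone : 1 ≤ Real.goldenRatio := Real.one_lt_goldenRatio.le
  have key : ∀ n, ((T n).card : ℝ) ≤ growthFunction S (n + k) := fun n => by
    rw [growthFunction, ← Set.ncard_coe_finset]
    exact_mod_cast Set.ncard_le_ncard (fun g hg => hlen n g hg) (wordBall_finite hS _)
  -- The shift by `k` costs a factor φ^k. The minimum with 1 keeps the bound at most 1 for `n ≤ k`,
  -- where only the trivial estimate `1 ≤ growthFunction S n` is used.
  refine le_expGrowthRate_of_forall_le hS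
    (c := min c 1 / Real.goldenRatio ^ k) (by positivity) hpos fun n => ?_
  rcases le_total k n with h | h
  · obtain ⟨m, rfl⟩ := Nat.exists_eq_add_of_le' h
    refine le_trans ?_ ((hcard m).trans (key m))
    rw [pow_add, div_mul_eq_mul_div, ← mul_assoc, mul_div_assoc, div_self (by positivity), mul_one]
    gcongr
    exact min_le_left _ _
  · have h1 : (1 : ℝ) ≤ growthFunction S n := by exact_mod_cast one_le_growthFunction hS n
    refine le_trans ?_ h1
    rw [div_mul_eq_mul_div, div_le_one (by positivity)]
    calc min c 1 * Real.goldenRatio ^ n ≤ 1 * Real.goldenRatio ^ n := by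
          gcongr; exact min_le_right _ _
      _ ≤ _ := by rw [one_mul]; exact pow_le_pow_right₀ hone h

end Length

/-! ### Counting devices and the upper bound √2 -/

section Counting

open scoped Pointwise

variable {G : Type*} [Group G] {S : Finset G}

/-- Three elements of lengths `2, 2, 3` playing ping-pong on a set. -/
theorem goldenRatio_le_of_three_maps (hS : Subgroup.closure (S : Set G) = ⊤)
    {Z : Set G} (hZ : Z.Nonempty) {α β γ : G}
    (hα : α • Z ⊆ Z) (hβ : β • Z ⊆ Z) (hγ : γ • Z ⊆ Z)
    (hαβ : Disjoint (α • Z) (β • Z)) (hαγ : Disjoint (α • Z) (γ • Z))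
    (hβγ : Disjoint (β • Z) (γ • Z))
    (lα : wordLength S α ≤ 2) (lβ : wordLength S β ≤ 2) (lγ : wordLength S γ ≤ 3) :
    Real.goldenRatio ≤ expGrowthRate S := by
  classical
  obtain ⟨z, hz⟩ := hZ
  -- The state holds three consecutive sets, so that a recursion of depth three becomes an
  -- iteration. The three seeds `{z}` account for the constant 1/φ² below.
  let T : ℕ → Finset G × Finset G × Finset G := fun n => n.rec ({z}, {z}, {z})
    fun _ p => (p.2.1, p.2.2, α • p.2.1 ∪ β • p.2.1 ∪ γ • p.1)
  generalize hU : (fun n => (T n).1) = U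
  have hU0 : U 0 = {z} := by rw [← hU]; rfl
  have hU1 : U 1 = {z} := by rw [← hU]; rfl
  have hU2 : U 2 = {z} := by rw [← hU]; rfl
  have hU3 : ∀ n, U (n + 3) = α • U (n + 1) ∪ β • U (n + 1) ∪ γ • U n := by
    intro n; rw [← hU]
  clear hU
  have main : ∀ n, ((U n : Set G) ⊆ Z ∧ (∀ g ∈ U n, wordLength S g ≤ n + wordLength S z) ∧
      (1 / Real.goldenRatio ^ 2) * Real.goldenRatio ^ n ≤ (U n).card) := by
    intro n
    have hpos := Real.goldenRatio_pos
    have hone : 1 ≤ Real.goldenRatio := Real.one_lt_goldenRatio.le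
    induction n using Nat.strong_induction_on with
    | _ n ih =>
      match n, ih with
      | 0, _ =>
        rw [hU0]
        refine ⟨by simpa using hz, by simp, ?_⟩
        rw [one_div, inv_mul_le_iff₀ (by positivity)]
        rw [pow_zero, Finset.card_singleton, Nat.cast_one, mul_one]
        exact one_le_pow₀ hone
      | 1, _ =>
        rw [hU1]
        refine ⟨by simpa using hz, by simp, ?_⟩
        rw [one_div, inv_mul_le_iff₀ (by positivity)]
        simp only [pow_one, Finset.card_singleton, Nat.cast_one, mul_one]
        exact le_self_pow₀ hone two_ne_zero
      | 2, _ =>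
        rw [hU2]
        refine ⟨by simpa using hz, by simp, ?_⟩
        rw [one_div, inv_mul_le_iff₀ (by positivity)]
        simp
      | n + 3, ih =>
        obtain ⟨s1, l1, c1⟩ := ih (n + 1) (by omega)
        obtain ⟨s0, l0, c0⟩ := ih n (by omega)
        rw [hU3]
        have i1 : ((α • U (n + 1) : Finset G) : Set G) ⊆ α • Z := by
          rw [Finset.coe_smul_finset]; exact Set.smul_set_mono s1
        have i2 : ((β • U (n + 1) : Finset G) : Set G) ⊆ β • Z := by
          rw [Finset.coe_smul_finset]; exact Set.smul_set_mono s1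
        have i3 : ((γ • U n : Finset G) : Set G) ⊆ γ • Z := by
          rw [Finset.coe_smul_finset]; exact Set.smul_set_mono s0
        refine ⟨?_, ?_, ?_⟩
        · rw [Finset.coe_union, Finset.coe_union]
          exact Set.union_subset (Set.union_subset (i1.trans hα) (i2.trans hβ)) (i3.trans hγ)
        · intro g hg
          simp only [Finset.mem_union, Finset.mem_smul_finset, smul_eq_mul] at hg
          rcases hg with (⟨w, hw, rfl⟩ | ⟨w, hw, rfl⟩) | ⟨w, hw, rfl⟩
          · have := wordLength_mul_le hS α w
            have := l1 w hw
            omega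
          · have := wordLength_mul_le hS β w
            have := l1 w hw
            omega
          · have := wordLength_mul_le hS γ w
            have := l0 w hw
            omega
        · have d1 : Disjoint (α • U (n + 1)) (β • U (n + 1)) :=
            Finset.disjoint_coe.1 (hαβ.mono i1 i2)
          have d2 : Disjoint (α • U (n + 1) ∪ β • U (n + 1)) (γ • U n) := by
            rw [Finset.disjoint_union_left]
            exact ⟨Finset.disjoint_coe.1 (hαγ.mono i1 i3), Finset.disjoint_coe.1 (hβγ.mono i2 i3)⟩
          rw [Finset.card_union_of_disjoint d2, Finset.card_union_of_disjoint d1]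
          simp only [Finset.card_smul_finset]
          push_cast
          -- This is φ³ = 2φ + 1, from x³ - 2x - 1 = (x + 1)(x² - x - 1).
          have e : Real.goldenRatio ^ (n + 3) =
              2 * Real.goldenRatio ^ (n + 1) + Real.goldenRatio ^ n := by
            have := Real.goldenRatio_sq
            linear_combination
              (Real.goldenRatio ^ n) * (Real.goldenRatio + 1) * this
          rw [e]
          linarith
  exact goldenRatio_le_expGrowthRate_of_finset hS U _ (fun n => (main n).2.1)
    (by have := Real.goldenRatio_pos; positivity) fun n => (main n).2.2

/-- A two-state automaton whose transitions cost one and two letters. -/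
theorem goldenRatio_le_of_two_states (hS : Subgroup.closure (S : Set G) = ⊤)
    {Z : Bool → Set G} (hZ : ∀ i, (Z i).Nonempty) {α β : Bool → G} {σ τ : Bool → Bool}
    (hα : ∀ i, α i • Z (σ i) ⊆ Z i) (hβ : ∀ i, β i • Z (τ i) ⊆ Z i)
    (hαβ : ∀ i, Disjoint (α i • Z (σ i)) (β i • Z (τ i)))
    (lα : ∀ i, wordLength S (α i) ≤ 1) (lβ : ∀ i, wordLength S (β i) ≤ 2) :
    Real.goldenRatio ≤ expGrowthRate S := by
  classical
  choose z hz using hZ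
  let T : ℕ → (Bool → Finset G) × (Bool → Finset G) := fun n =>
    n.rec (fun i => {z i}, fun i => {z i})
      fun _ p => (p.2, fun i => α i • p.2 (σ i) ∪ β i • p.1 (τ i))
  generalize hU : (fun n => (T n).1) = U
  have hU0 : ∀ i, U 0 i = {z i} := by intro i; rw [← hU]; rfl
  have hU1 : ∀ i, U 1 i = {z i} := by intro i; rw [← hU]; rfl
  have hU2 : ∀ n i, U (n + 2) i = α i • U (n + 1) (σ i) ∪ β i • U n (τ i) := by
    intro n i; rw [← hU]
  clear hU
  set k := wordLength S (z true) + wordLength S (z false) with hk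
  have hzk : ∀ i, wordLength S (z i) ≤ k := by rintro (_ | _) <;> omega
  have main : ∀ n i, ((U n i : Set G) ⊆ Z i ∧ (∀ g ∈ U n i, wordLength S g ≤ n + k) ∧
      (1 / Real.goldenRatio) * Real.goldenRatio ^ n ≤ (U n i).card) := by
    intro n
    have hpos := Real.goldenRatio_pos
    have hone : 1 ≤ Real.goldenRatio := Real.one_lt_goldenRatio.le
    induction n using Nat.strong_induction_on with
    | _ n ih =>
      intro i
      match n, ih with
      | 0, _ =>
        rw [hU0]
        refine ⟨by simpa using hz i, by simpa using hzk i, ?_⟩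
        rw [one_div, inv_mul_le_iff₀ (by positivity)]
        simpa using hone
      | 1, _ =>
        rw [hU1]
        refine ⟨by simpa using hz i, by simpa using (hzk i).trans (by omega), ?_⟩
        rw [one_div, inv_mul_le_iff₀ (by positivity)]
        simp
      | n + 2, ih =>
        obtain ⟨s1, l1, c1⟩ := ih (n + 1) (by omega) (σ i)
        obtain ⟨s0, l0, c0⟩ := ih n (by omega) (τ i)
        rw [hU2]
        have i1 : ((α i • U (n + 1) (σ i) : Finset G) : Set G) ⊆ α i • Z (σ i) := by
          rw [Finset.coe_smul_finset]; exact Set.smul_set_mono s1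
        have i2 : ((β i • U n (τ i) : Finset G) : Set G) ⊆ β i • Z (τ i) := by
          rw [Finset.coe_smul_finset]; exact Set.smul_set_mono s0
        refine ⟨?_, ?_, ?_⟩
        · rw [Finset.coe_union]
          exact Set.union_subset (i1.trans (hα i)) (i2.trans (hβ i))
        · intro g hg
          simp only [Finset.mem_union, Finset.mem_smul_finset, smul_eq_mul] at hg
          rcases hg with ⟨w, hw, rfl⟩ | ⟨w, hw, rfl⟩
          · have := wordLength_mul_le hS (α i) w
            have := l1 w hw
            have := lα i
            omega
          · have := wordLength_mul_le hS (β i) w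
            have := l0 w hw
            have := lβ i
            omega
        · have d1 : Disjoint (α i • U (n + 1) (σ i)) (β i • U n (τ i)) :=
            Finset.disjoint_coe.1 ((hαβ i).mono i1 i2)
          rw [Finset.card_union_of_disjoint d1]
          simp only [Finset.card_smul_finset]
          push_cast
          have e : Real.goldenRatio ^ (n + 2) =
              Real.goldenRatio ^ (n + 1) + Real.goldenRatio ^ n := by
            have := Real.goldenRatio_sq
            linear_combination (Real.goldenRatio ^ n) * this
          rw [e]
          linarith
  exact goldenRatio_le_expGrowthRate_of_finset hS (fun n => U n true) _
    (fun n => (main n true).2.1)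
    (by have := Real.goldenRatio_pos; positivity) fun n => (main n true).2.2

/-- Two elements that play ping-pong as generators of a free monoid. -/
def PingPong (u v : G) : Prop :=
  ∃ P Q : Set G, P.Nonempty ∧ Q.Nonempty ∧ Disjoint P Q ∧
    u • P ⊆ P ∧ u • Q ⊆ P ∧ v • P ⊆ Q ∧ v • Q ⊆ Q

theorem PingPong.symm {u v : G} (h : PingPong u v) : PingPong v u := by
  obtain ⟨P, Q, hP, hQ, d, h1, h2, h3, h4⟩ := h
  exact ⟨Q, P, hQ, hP, d.symm, h4, h3, h2, h1⟩

theorem disjoint_smul_smul {P Q : Set G} (d : Disjoint P Q) (g : G) : Disjoint (g • P) (g • Q) := by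
  rw [Set.disjoint_iff_inter_eq_empty, ← Set.smul_set_inter, d.inter_eq, Set.smul_set_empty]

/-- In a product of copies of h and sh's⁻¹, adjacent conjugates share their s. The state records
whether an s is open: staying costs one letter, and switching costs one more for s or s⁻¹. -/
theorem PingPong.goldenRatio_le_of_conj (hS : Subgroup.closure (S : Set G) = ⊤) {h h' s : G}
    (hh : IsLetter S h) (hh' : IsLetter S h') (hs : IsLetter S s)
    (hpp : PingPong h (s * h' * s⁻¹)) : Real.goldenRatio ≤ expGrowthRate S := by
  obtain ⟨P, Q, hP, hQ, d, h1, h2, h3, h4⟩ := hpp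
  have e1 : h' • s⁻¹ • Q = s⁻¹ • (s * h' * s⁻¹) • Q := by simp [smul_smul, mul_assoc]
  have e2 : (h' * s⁻¹) • P = s⁻¹ • (s * h' * s⁻¹) • P := by simp [smul_smul, mul_assoc]
  have e3 : (h * s) • s⁻¹ • Q = h • Q := by simp [smul_smul, mul_assoc]
  refine goldenRatio_le_of_two_states hS (Z := fun i => bif i then P else s⁻¹ • Q)
    (α := fun i => bif i then h else h') (β := fun i => bif i then h * s else h' * s⁻¹)
    (σ := id) (τ := not) ?_ ?_ ?_ ?_ ?_ ?_
  · rintro (_ | _)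
    · exact hQ.smul_set
    · exact hP
  · rintro (_ | _)
    · change h' • s⁻¹ • Q ⊆ s⁻¹ • Q
      rw [e1]; exact Set.smul_set_mono h4
    · exact h1
  · rintro (_ | _)
    · change (h' * s⁻¹) • P ⊆ s⁻¹ • Q
      rw [e2]; exact Set.smul_set_mono h3
    · change (h * s) • s⁻¹ • Q ⊆ P
      rw [e3]; exact h2
  · rintro (_ | _)
    · change Disjoint (h' • s⁻¹ • Q) ((h' * s⁻¹) • P)
      rw [e1, e2]; exact disjoint_smul_smul (disjoint_smul_smul d.symm _) _
    · change Disjoint (h • P) ((h * s) • s⁻¹ • Q)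
      rw [e3]; exact disjoint_smul_smul d _
  · rintro (_ | _)
    · exact hh'.wordLength_le
    · exact hh.wordLength_le
  · rintro (_ | _)
    · exact hh'.wordLength_mul_le hs.inv
    · exact hh.wordLength_mul_le hs

/-- In a product of copies of xy and y⁻¹z, every y y⁻¹ cancels. In the state `y • Q` the next factor
has already lost its y⁻¹, so changing state costs one letter and staying costs two. -/
theorem PingPong.goldenRatio_le_of_mul (hS : Subgroup.closure (S : Set G) = ⊤) {x y z : G}
    (hx : IsLetter S x) (hy : IsLetter S y) (hz : IsLetter S z)
    (hpp : PingPong (x * y) (y⁻¹ * z)) : Real.goldenRatio ≤ expGrowthRate S := by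
  obtain ⟨P, Q, hP, hQ, d, h1, h2, h3, h4⟩ := hpp
  have e1 : z • P = y • (y⁻¹ * z) • P := by simp [smul_smul]
  have e2 : (z * y⁻¹) • y • Q = y • (y⁻¹ * z) • Q := by simp [smul_smul]
  have e3 : x • y • Q = (x * y) • Q := by simp [smul_smul]
  refine goldenRatio_le_of_two_states hS (Z := fun i => bif i then P else y • Q)
    (α := fun i => bif i then x else z) (β := fun i => bif i then x * y else z * y⁻¹)
    (σ := not) (τ := id) ?_ ?_ ?_ ?_ ?_ ?_
  · rintro (_ | _)
    · exact hQ.smul_set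
    · exact hP
  · rintro (_ | _)
    · change z • P ⊆ y • Q
      rw [e1]; exact Set.smul_set_mono h3
    · change x • y • Q ⊆ P
      rw [e3]; exact h2
  · rintro (_ | _)
    · change (z * y⁻¹) • y • Q ⊆ y • Q
      rw [e2]; exact Set.smul_set_mono h4
    · exact h1
  · rintro (_ | _)
    · change Disjoint (z • P) ((z * y⁻¹) • y • Q)
      rw [e1, e2]; exact disjoint_smul_smul (disjoint_smul_smul d _) _
    · change Disjoint (x • y • Q) ((x * y) • P)
      rw [e3]; exact disjoint_smul_smul d.symm _
  · rintro (_ | _)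
    · exact hz.wordLength_le
    · exact hx.wordLength_le
  · rintro (_ | _)
    · exact hz.wordLength_mul_le hy.inv
    · exact hx.wordLength_mul_le hy

/-- Two generators of orders two and at most three. -/
theorem expGrowthRate_le_sqrt_two (hS : Subgroup.closure (S : Set G) = ⊤) {a b : G}
    (hab : ∀ s ∈ S, s = a ∨ s = b) (ha : a * a = 1) (hb : b * b = 1 ∨ b * b = b⁻¹) :
    expGrowthRate S ≤ √2 := by
  classical
  -- The components of `T n` consist of the alternating words of length `n` that begin with `a`,
  -- respectively with `b` or `b⁻¹`; `U n` collects those of length at most `n`.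
  let T : ℕ → Finset G × Finset G := fun n =>
    n.rec ({1}, {1}) fun _ p => (a • p.2, b • p.1 ∪ b⁻¹ • p.1)
  let U : ℕ → Finset G := fun n => (Finset.range (n + 1)).biUnion fun k => (T k).1 ∪ (T k).2
  have ha' : a⁻¹ = a := inv_eq_of_mul_eq_one_left ha
  have h0 : (T 0).1 = {1} ∧ (T 0).2 = {1} := ⟨rfl, rfl⟩
  have h1 : ∀ n, (T (n + 1)).1 = a • (T n).2 := fun n => rfl
  have h2 : ∀ n, (T (n + 1)).2 = b • (T n).1 ∪ b⁻¹ • (T n).1 := fun n => rfl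
  have mono : Monotone U := fun m n hmn => by
    refine Finset.biUnion_subset_biUnion_of_subset_left _ ?_
    exact Finset.range_mono (by omega)
  have memU : ∀ {n k g}, k ≤ n → (g ∈ (T k).1 ∨ g ∈ (T k).2) → g ∈ U n := fun hk hg =>
    Finset.mem_biUnion.2 ⟨_, Finset.mem_range.2 (Nat.lt_succ_of_le hk), Finset.mem_union.2 hg⟩
  have smul_left : ∀ k g, g ∈ (T k).1 → a * g ∈ U (k + 1) := by
    intro k g hg
    cases k with
    | zero =>
      rw [h0.1, Finset.mem_singleton] at hg
      subst hg
      refine memU (k := 1) le_rfl (Or.inl ?_)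
      rw [show (T 1).1 = _ from h1 0, h0.2]
      simp
    | succ k =>
      rw [h1] at hg
      obtain ⟨w, hw, rfl⟩ := Finset.mem_smul_finset.1 hg
      refine memU (k := k) (by omega) (Or.inr ?_)
      simpa [← mul_assoc, ha] using hw
  have smul_right : ∀ k g, g ∈ (T k).2 → b * g ∈ U (k + 1) ∧ b⁻¹ * g ∈ U (k + 1) := by
    intro k g hg
    cases k with
    | zero =>
      rw [h0.2, Finset.mem_singleton] at hg
      subst hg
      constructor <;> refine memU (k := 1) le_rfl (Or.inr ?_) <;> 
        rw [show (T 1).2 = _ from h2 0, h0.1] <;> simp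
    | succ k =>
      rw [h2, Finset.mem_union] at hg
      have hk : k ≤ k + 1 + 1 := by omega
      have hb' : b⁻¹ * b⁻¹ = 1 ∨ b⁻¹ * b⁻¹ = b := by
        rcases hb with hb | hb
        · left; rw [← mul_inv_rev, hb, inv_one]
        · right; rw [← mul_inv_rev, hb, inv_inv]
      rcases hg with hg | hg <;> obtain ⟨w, hw, rfl⟩ := Finset.mem_smul_finset.1 hg <;>
        simp only [smul_eq_mul]
      · refine ⟨?_, memU hk (Or.inl (by simpa using hw))⟩
        rw [← mul_assoc]
        rcases hb with hb | hb <;> rw [hb]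
        · exact memU hk (Or.inl (by simpa using hw))
        · refine memU (k := k + 1) (by omega) (Or.inr ?_)
          rw [h2]
          exact Finset.mem_union_right _ (Finset.smul_mem_smul_finset hw)
      · refine ⟨memU hk (Or.inl (by simpa using hw)), ?_⟩
        rw [← mul_assoc]
        rcases hb' with hb | hb <;> rw [hb]
        · exact memU hk (Or.inl (by simpa using hw))
        · refine memU (k := k + 1) (by omega) (Or.inr ?_)
          rw [h2]
          exact Finset.mem_union_left _ (Finset.smul_mem_smul_finset hw)
  have other : ∀ k g, (g ∈ (T k).1 → b * g ∈ U (k + 1) ∧ b⁻¹ * g ∈ U (k + 1)) ∧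
      (g ∈ (T k).2 → a * g ∈ U (k + 1)) := by
    refine fun k g => ⟨fun hg => ⟨?_, ?_⟩, fun hg => ?_⟩
    · refine memU (k := k + 1) le_rfl (Or.inr ?_)
      rw [h2]
      exact Finset.mem_union_left _ (Finset.smul_mem_smul_finset hg)
    · refine memU (k := k + 1) le_rfl (Or.inr ?_)
      rw [h2]
      exact Finset.mem_union_right _ (Finset.smul_mem_smul_finset hg)
    · refine memU (k := k + 1) le_rfl (Or.inl ?_)
      rw [h1]
      exact Finset.smul_mem_smul_finset hg
  -- A further letter on the left extends an alternating word, cancels its first letter, or merges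
  -- with it by `b * b = b⁻¹`.
  have step : ∀ s, (s ∈ S ∨ s⁻¹ ∈ S) → ∀ n g, g ∈ U n → s * g ∈ U (n + 1) := by
    intro s hs n g hg
    obtain ⟨k, hk, hg⟩ := Finset.mem_biUnion.1 hg
    have hs' : s = a ∨ s = b ∨ s = b⁻¹ := by
      rcases hs with hs | hs <;> rcases hab _ hs with h | h
      · exact Or.inl h
      · exact Or.inr (Or.inl h)
      · left; rw [← ha', ← h, inv_inv]
      · right; right; rw [← h, inv_inv]
    refine mono (Nat.lt_succ_iff.1 (by have := Finset.mem_range.1 hk; omega) : k + 1 ≤ n + 1) ?_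
    rcases Finset.mem_union.1 hg with hg | hg <;> rcases hs' with rfl | rfl | rfl
    · exact smul_left k g hg
    · exact ((other k g).1 hg).1
    · exact ((other k g).1 hg).2
    · exact (other k g).2 hg
    · exact (smul_right k g hg).1
    · exact (smul_right k g hg).2
  have hprod : ∀ l : List G, (∀ x ∈ l, x ∈ S ∨ x⁻¹ ∈ S) → l.prod ∈ U l.length := by
    intro l hl
    induction l with
    | nil => exact memU le_rfl (Or.inl (by rw [List.length_nil, h0.1]; simp))
    | cons x l ih =>
      rw [List.prod_cons, List.length_cons]
      exact step x (hl x (by simp)) _ _ (ih fun y hy => hl y (by simp [hy]))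
  have hcard : ∀ k, ((T k).1.card : ℝ) ≤ √2 ^ k ∧ ((T k).2.card : ℝ) ≤ √2 * √2 ^ k := by
    have hsq : √2 * √2 = 2 := Real.mul_self_sqrt zero_le_two
    intro k
    induction k with
    | zero =>
      rw [h0.1, h0.2]
      simp
    | succ k ih =>
      rw [h1, h2, Finset.card_smul_finset, pow_succ']
      refine ⟨ih.2, ?_⟩
      have := Finset.card_union_le (b • (T k).1) (b⁻¹ • (T k).1)
      rw [Finset.card_smul_finset, Finset.card_smul_finset] at this
      have h3 : (((b • (T k).1 ∪ b⁻¹ • (T k).1).card : ℕ) : ℝ) ≤ (T k).1.card + (T k).1.card := by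
        exact_mod_cast this
      rw [← mul_assoc, hsq]
      linarith [ih.1]
  have hone : (1 : ℝ) ≤ √2 := Real.one_le_sqrt.2 one_le_two
  have hU : ∀ n, ((U n).card : ℝ) ≤ (n + 1) * ((1 + √2) * √2 ^ n) := by
    intro n
    have : ((U n).card : ℝ) ≤ ∑ k ∈ Finset.range (n + 1), (1 + √2) * √2 ^ n := by
      refine (Nat.cast_le.2 Finset.card_biUnion_le).trans ?_
      rw [Nat.cast_sum]
      refine Finset.sum_le_sum fun k hk => ?_
      have h3 : (((T k).1 ∪ (T k).2).card : ℝ) ≤ (T k).1.card + (T k).2.card := by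
        exact_mod_cast Finset.card_union_le _ _
      have h4 : √2 ^ k ≤ √2 ^ n :=
        pow_le_pow_right₀ hone (by have := Finset.mem_range.1 hk; omega)
      have h5 := hcard k
      nlinarith
    simpa using this
  have hF : ∀ n, (growthFunction S n : ℝ) ≤ (n + 1) * ((1 + √2) * √2 ^ n) := by
    intro n
    refine le_trans ?_ (hU n)
    rw [growthFunction, ← Set.ncard_coe_finset]
    refine Nat.cast_le.2 (Set.ncard_le_ncard (fun g hg => ?_) (Finset.finite_toSet _))
    obtain ⟨l, hlen, hl, rfl⟩ := exists_list_wordLength hS g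
    have hg' : l.length ≤ n := by rw [hlen]; exact hg
    exact mono hg' (hprod l hl)
  -- The linear factor is absorbed by comparing with every r > √2.
  refine le_of_forall_gt_imp_ge_of_dense fun r hr => ?_
  have hr0 : 0 < r := (zero_lt_one.trans_le hone).trans hr
  have hq : √2 / r < 1 := (div_lt_one hr0).2 hr
  have hq0 : 0 ≤ √2 / r := by positivity
  have lim : Tendsto (fun n : ℕ => (1 + √2) * (n * (√2 / r) ^ n + (√2 / r) ^ n)) atTop (𝓝 0) := by
    simpa using ((tendsto_self_mul_const_pow_of_lt_one hq0 hq).add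
      (tendsto_pow_atTop_nhds_zero_of_lt_one hq0 hq)).const_mul (1 + √2)
  refine le_of_tendsto (tendsto_expGrowthRate hS) ?_
  filter_upwards [lim.eventually (gt_mem_nhds one_pos), eventually_gt_atTop 0] with n hn hn0
  have hn' : (n : ℝ) ≠ 0 := by exact_mod_cast hn0.ne'
  have hle : (growthFunction S n : ℝ) ≤ r ^ n := by
    refine (hF n).trans ?_
    rw [div_pow] at hn
    have : (1 + √2) * (n * (√2 ^ n / r ^ n) + √2 ^ n / r ^ n) =
        ((n + 1) * ((1 + √2) * √2 ^ n)) / r ^ n := by ring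
    rw [this, div_lt_one (by positivity)] at hn
    exact hn.le
  calc (growthFunction S n : ℝ) ^ (1 / (n : ℝ)) ≤ (r ^ n) ^ (1 / (n : ℝ)) :=
        Real.rpow_le_rpow (by positivity) hle (by positivity)
    _ = r := by
        rw [← Real.rpow_natCast, ← Real.rpow_mul hr0.le, mul_one_div_cancel hn', Real.rpow_one]

end Counting

/-! ### The Bass–Serre tree: normal forms, oriented edges and their order -/

/-- The normal form data of a decomposition of `G` as a free product of two nontrivial groups:
the factor `side g` that contains the first syllable of `g`, and the number `len g` of
syllables. -/
class FreeSplitting (G : Type*) [Group G] where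
  side : G → Option Bool
  len : G → ℕ
  factor : Bool → Subgroup G
  side_eq_none : ∀ g, side g = none ↔ g = 1
  side_mul : ∀ g h, g ≠ 1 → side g⁻¹ ≠ side h → side (g * h) = side g
  len_mul : ∀ g h, side g⁻¹ ≠ side h → len (g * h) = len g + len h
  len_pos : ∀ g, g ≠ 1 → 0 < len g
  side_of_mem : ∀ i, ∀ g ∈ factor i, g ≠ 1 → side g = some i
  len_of_mem : ∀ i, ∀ g ∈ factor i, g ≠ 1 → len g = 1
  exists_factor : ∀ g i, side g = some i → ∃ a ∈ factor i, a ≠ 1 ∧ ∃ h, g = a * h ∧ side h ≠ some i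
  factor_nontrivial : ∀ i, ∃ g ∈ factor i, g ≠ 1

/-- Oriented edges of the Bass-Serre tree of a free product. -/
@[ext]
structure OrientedEdge (G : Type*) where
  base : G
  dir : Bool

namespace OrientedEdge

/-- The same edge with the opposite orientation. -/
def rev {G : Type*} (e : OrientedEdge G) : OrientedEdge G := ⟨e.base, !e.dir⟩

@[simp]
theorem rev_rev {G : Type*} (e : OrientedEdge G) : e.rev.rev = e := by simp [rev]

@[simp] theorem rev_base {G : Type*} (e : OrientedEdge G) : e.rev.base = e.base := rfl
@[simp] theorem rev_dir {G : Type*} (e : OrientedEdge G) : e.rev.dir = !e.dir := rfl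

theorem rev_ne {G : Type*} (e : OrientedEdge G) : e.rev ≠ e := fun h => by
  have := congrArg dir h
  simp at this

variable {G : Type*} [Group G]

instance : MulAction G (OrientedEdge G) where
  smul g e := ⟨g * e.base, e.dir⟩
  one_smul e := by ext <;> simp [HSMul.hSMul]
  mul_smul g h e := by ext <;> simp [HSMul.hSMul, mul_assoc]

@[simp] theorem smul_base (g : G) (e : OrientedEdge G) : (g • e).base = g * e.base := rfl
@[simp] theorem smul_dir (g : G) (e : OrientedEdge G) : (g • e).dir = e.dir := rfl

theorem smul_rev (g : G) (e : OrientedEdge G) : g • e.rev = (g • e).rev := rfl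

end OrientedEdge

namespace FreeSplitting

open OrientedEdge

variable {G : Type*} [Group G] [FreeSplitting G]

@[simp]
theorem side_one : side (1 : G) = none := (side_eq_none 1).2 rfl

theorem ne_one_of_side {g : G} {i : Bool} (h : side g = some i) : g ≠ 1 := by
  rintro rfl
  simp at h

theorem exists_side {g : G} (hg : g ≠ 1) : ∃ i, side g = some i :=
  Option.ne_none_iff_exists'.1 fun h => hg ((side_eq_none g).1 h)

/-- Since `side g⁻¹` is the factor of the last syllable of `g`, the last hypothesis says that
nothing cancels or merges in `g * h`. -/
theorem side_mul_of_ne {g h : G} {i j : Bool} (hg : side g = some i) (hg' : side g⁻¹ = some j)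
    (hh : side h ≠ some j) : side (g * h) = some i := by
  rw [← hg]
  exact side_mul _ _ (ne_one_of_side hg) (by rw [hg']; exact hh.symm)

/-- `e < f` if a path of the tree runs through `e` and later through `f`, respecting both
orientations. -/
instance : PartialOrder (OrientedEdge G) where
  lt e f := side (e.base⁻¹ * f.base) = some e.dir ∧ side (f.base⁻¹ * e.base) = some (!f.dir)
  le e f := e = f ∨
    (side (e.base⁻¹ * f.base) = some e.dir ∧ side (f.base⁻¹ * e.base) = some (!f.dir))
  le_refl e := Or.inl rfl
  le_trans := by
    rintro e f g (rfl | ⟨h1, h2⟩) (rfl | ⟨h3, h4⟩)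
    · exact Or.inl rfl
    · exact Or.inr ⟨h3, h4⟩
    · exact Or.inr ⟨h1, h2⟩
    · right
      have e1 : e.base⁻¹ * g.base = (e.base⁻¹ * f.base) * (f.base⁻¹ * g.base) := by group
      have e2 : g.base⁻¹ * e.base = (g.base⁻¹ * f.base) * (f.base⁻¹ * e.base) := by group
      rw [e1, e2]
      exact ⟨side_mul_of_ne h1 (by simpa using h2) (by simp [h3]),
        side_mul_of_ne h4 (by simpa using h3) (by simp [h2])⟩
  le_antisymm := by
    rintro e f (rfl | ⟨h1, h2⟩) (h | ⟨h3, h4⟩)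
    · rfl
    · rfl
    · exact h.symm
    · rw [h1] at h4
      simp at h4
  lt_iff_le_not_ge := by
    intro e f
    constructor
    · rintro ⟨h1, h2⟩
      refine ⟨Or.inr ⟨h1, h2⟩, ?_⟩
      rintro (rfl | ⟨h3, h4⟩)
      · simp at h1
      · rw [h1] at h4
        simp at h4
    · rintro ⟨rfl | h, h'⟩
      · exact absurd (Or.inl rfl) h'
      · exact h

theorem lt_def {e f : OrientedEdge G} : e < f ↔
    side (e.base⁻¹ * f.base) = some e.dir ∧ side (f.base⁻¹ * e.base) = some (!f.dir) := Iff.rfl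

theorem rev_lt_rev {e f : OrientedEdge G} : e.rev < f.rev ↔ f < e := by
  simp [lt_def, and_comm]

theorem rev_lt {e f : OrientedEdge G} : e.rev < f ↔ f.rev < e := by
  rw [← rev_lt_rev, rev_rev]

theorem lt_rev {e f : OrientedEdge G} : e < f.rev ↔ f < e.rev := by
  rw [← rev_lt_rev, rev_rev]

theorem rev_le_rev {e f : OrientedEdge G} : e.rev ≤ f.rev ↔ f ≤ e := by
  rw [le_iff_lt_or_eq, le_iff_lt_or_eq, rev_lt_rev]
  refine or_congr Iff.rfl ⟨fun h => ?_, fun h => by rw [h]⟩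
  rw [← rev_rev f, ← h, rev_rev]

theorem smul_lt_smul {g : G} {e f : OrientedEdge G} : g • e < g • f ↔ e < f := by
  simp [lt_def]

theorem smul_le_smul {g : G} {e f : OrientedEdge G} : g • e ≤ g • f ↔ e ≤ f := by
  rw [le_iff_lt_or_eq, le_iff_lt_or_eq, smul_lt_smul, smul_left_cancel_iff]

theorem not_lt_of_base_eq {e f : OrientedEdge G} (h : e.base = f.base) : ¬ e < f := by
  rintro ⟨h1, -⟩
  simp [h] at h1

theorem not_le_rev (e : OrientedEdge G) : ¬ e ≤ e.rev := fun h =>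
  not_lt_of_base_eq (e := e) (f := e.rev) rfl (lt_of_le_of_ne h (rev_ne e).symm)

theorem not_rev_le (e : OrientedEdge G) : ¬ e.rev ≤ e := fun h =>
  not_lt_of_base_eq (e := e.rev) (f := e) rfl (lt_of_le_of_ne h (rev_ne e))

/-- No edge is followed by both orientations of another one. With the dual statement below, this
excludes most impossible configurations later. -/
theorem not_le_and_le_rev {c e : OrientedEdge G} (h : c ≤ e) (h' : c ≤ e.rev) : False := by
  rcases h.eq_or_lt with rfl | h
  · exact not_le_rev _ h'
  rcases h'.eq_or_lt with rfl | h'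
  · exact not_rev_le _ h.le
  have h1 := h'.2
  rw [rev_base, h.2] at h1
  simp at h1

theorem not_le_and_rev_le {c e : OrientedEdge G} (h : e ≤ c) (h' : e.rev ≤ c) : False :=
  not_le_and_le_rev (rev_le_rev.2 h) (rev_le_rev.2 h')

/-- For edges with distinct bases, the first syllables of the two quotients of the bases decide
which end of each edge faces the other. The four outcomes are the four strict relations. -/
theorem trichotomy (e f : OrientedEdge G) :
    e = f ∨ e = f.rev ∨ e < f ∨ f < e ∨ e < f.rev ∨ e.rev < f := by
  by_cases h : e.base = f.base
  · rcases eq_or_ne e.dir f.dir with hd | hd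
    · exact Or.inl (OrientedEdge.ext h hd)
    · exact Or.inr (Or.inl (OrientedEdge.ext h (by simpa [Bool.eq_not] using hd)))
  · right; right
    obtain ⟨i, hi⟩ := exists_side (g := e.base⁻¹ * f.base) (by rwa [ne_eq, inv_mul_eq_one])
    obtain ⟨j, hj⟩ := exists_side (g := f.base⁻¹ * e.base)
      (by rw [ne_eq, inv_mul_eq_one]; exact fun h' => h h'.symm)
    simp only [lt_def, rev_base, rev_dir, hi, hj, Option.some.injEq]
    cases i <;> cases j <;> cases e.dir <;> cases f.dir <;> simp

/-- The edges of a segment of the tree are linearly ordered. -/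
theorem comparable {c d e f : OrientedEdge G} (hce : c ≤ e) (hcf : c ≤ f) (hed : e ≤ d)
    (hfd : f ≤ d) : e < f ∨ f ≤ e := by
  rcases trichotomy e f with h | h | h | h | h | h
  · exact Or.inr h.ge
  · exact (not_le_and_le_rev hcf (h ▸ hce)).elim
  · exact Or.inl h
  · exact Or.inr h.le
  · exact (not_le_and_le_rev hcf (hce.trans h.le)).elim
  · exact (not_le_and_rev_le hed (h.le.trans hfd)).elim

/-! ### Half-trees -/

/-- The elements of `G` that, as edges, lie beyond the oriented edge `e`. -/
def half (e : OrientedEdge G) : Set G := {x | side (e.base⁻¹ * x) = some e.dir}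

open scoped Pointwise in
theorem smul_half (g : G) (e : OrientedEdge G) : g • half e = half (g • e) := by
  ext x
  simp [Set.mem_smul_set_iff_inv_smul_mem, half, mul_assoc]

theorem half_anti {e f : OrientedEdge G} (h : e ≤ f) : half f ⊆ half e := by
  rcases h.eq_or_lt with rfl | h
  · rfl
  intro x hx
  have e1 : e.base⁻¹ * x = (e.base⁻¹ * f.base) * (f.base⁻¹ * x) := by group
  change side (e.base⁻¹ * x) = some e.dir
  rw [e1]
  refine side_mul_of_ne h.1 (by simpa using h.2) ?_
  rw [show side (f.base⁻¹ * x) = some f.dir from hx]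
  simp

theorem disjoint_half_rev (e : OrientedEdge G) : Disjoint (half e) (half e.rev) := by
  rw [Set.disjoint_left]
  intro x hx hx'
  simp only [half, Set.mem_ofPred_eq, rev_base, rev_dir] at hx hx'
  rw [hx] at hx'
  simp at hx'

theorem disjoint_half {e f : OrientedEdge G} (h : e.rev ≤ f) : Disjoint (half e) (half f) :=
  (disjoint_half_rev e).mono_right (half_anti h)

theorem half_nonempty (e : OrientedEdge G) : (half e).Nonempty := by
  obtain ⟨g, hg, hg1⟩ := factor_nontrivial (G := G) e.dir
  exact ⟨e.base * g, by simpa [half] using side_of_mem _ g hg hg1⟩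

/-- The sets are the half-trees beyond `E` and `F`; inclusions of half-trees reverse the order of
edges. -/
theorem pingPong_of_le {g h : G} {E F : OrientedEdge G} (hE : E ≤ h • E) (hF : F ≤ g • F)
    (hEF : E.rev ≤ F) (hEF' : E ≤ h • F) (hFE : F ≤ g • E) : PingPong h g := by
  refine ⟨half E, half F, half_nonempty E, half_nonempty F, disjoint_half hEF, ?_, ?_, ?_, ?_⟩ <;>
    rw [smul_half] <;> apply half_anti <;> assumption

/-! ### Axes -/

/-- The axis of a hyperbolic element, oriented in the direction of the translation; empty for other
elements. -/
def axis (u : G) : Set (OrientedEdge G) := {e | e < u • e}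

theorem mem_axis {u : G} {e : OrientedEdge G} : e ∈ axis u ↔ e < u • e := Iff.rfl

theorem rev_mem_axis_inv {u : G} {e : OrientedEdge G} : e.rev ∈ axis u⁻¹ ↔ e ∈ axis u := by
  rw [mem_axis, mem_axis, ← smul_lt_smul (g := u), smul_inv_smul, smul_rev, rev_lt_rev]

theorem mem_axis_inv {u : G} {e : OrientedEdge G} : e ∈ axis u⁻¹ ↔ e.rev ∈ axis u := by
  rw [← rev_mem_axis_inv (u := u) (e := e.rev), rev_rev]

theorem smul_mem_axis_conj {u : G} (s : G) {e : OrientedEdge G} (h : e ∈ axis u) :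
    s • e ∈ axis (s * u * s⁻¹) := by
  rw [mem_axis, smul_smul, inv_mul_cancel_right, mul_smul, smul_lt_smul]
  exact h

theorem zpow_smul_mem_axis {u : G} {e : OrientedEdge G} (h : e ∈ axis u) (n : ℤ) :
    u ^ n • e ∈ axis u := by
  have h1 := smul_mem_axis_conj (u ^ n) h
  have h2 : u ^ n * u * (u ^ n)⁻¹ = u := by group
  rwa [h2] at h1

theorem pow_smul_mem_axis {u : G} {e : OrientedEdge G} (h : e ∈ axis u) (n : ℕ) :
    u ^ n • e ∈ axis u := by
  simpa using zpow_smul_mem_axis h n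

theorem pow_smul_lt_succ {u : G} {e : OrientedEdge G} (h : e ∈ axis u) (n : ℕ) :
    u ^ n • e < u ^ (n + 1) • e := by
  rw [pow_succ', mul_smul]
  exact pow_smul_mem_axis h n

theorem pow_smul_mono {u : G} {e : OrientedEdge G} (h : e ∈ axis u) :
    Monotone fun n : ℕ => u ^ n • e :=
  monotone_nat_of_le_succ fun n => (pow_smul_lt_succ h n).le

theorem le_pow_smul {u : G} {e : OrientedEdge G} (h : e ∈ axis u) (n : ℕ) : e ≤ u ^ n • e := by
  simpa using pow_smul_mono h (Nat.zero_le n)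

/-- Each translation along the axis uses up at least one syllable. Hence the Archimedean property
that follows: the powers of `u` carry an edge of the axis past any bound. -/
theorem lt_len_of_pow_smul_lt {u : G} {c : OrientedEdge G} (n : ℕ) :
    ∀ {e : OrientedEdge G}, e ∈ axis u → u ^ n • e < c → n < len (e.base⁻¹ * c.base) := by
  induction n with
  | zero =>
    intro e _ hc
    rw [pow_zero, one_smul] at hc
    exact len_pos _ (ne_one_of_side hc.1)
  | succ n ih =>
    intro e he hc
    rw [pow_succ, mul_smul] at hc
    have he' : u • e ∈ axis u := by simpa using pow_smul_mem_axis he 1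
    have h1 := ih he' hc
    have h2 : u • e < c := (le_pow_smul he' n).trans_lt hc
    have h3 : e.base⁻¹ * c.base = (e.base⁻¹ * (u • e).base) * ((u • e).base⁻¹ * c.base) := by group
    rw [h3, len_mul _ _ (by
      rw [h2.1, mul_inv_rev, inv_inv, (mem_axis.1 he).2]; simp)]
    have := len_pos _ (ne_one_of_side (mem_axis.1 he).1)
    omega

theorem exists_not_pow_smul_lt {u : G} {e : OrientedEdge G} (he : e ∈ axis u)
    (c : OrientedEdge G) : ∃ n : ℕ, ¬ u ^ n • e < c :=
  ⟨_, fun h => (lt_len_of_pow_smul_lt _ he h).false⟩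

/-- If two edges of the axis faced each other, all positive translates of the first would stay below
the reverse of the second, against the Archimedean property. Thus an axis is linearly ordered. -/
theorem not_lt_rev_of_mem_axis {u : G} {e f : OrientedEdge G} (he : e ∈ axis u)
    (hf : f ∈ axis u) : ¬ e < f.rev := by
  intro h
  obtain ⟨n, hn⟩ := exists_not_pow_smul_lt he f.rev
  refine hn ?_
  clear hn
  induction n with
  | zero => simpa using h
  | succ n ih =>
    rw [pow_succ', mul_smul]
    refine (smul_lt_smul.2 ih).trans ?_
    rw [smul_rev, rev_lt_rev]
    exact hf

theorem lt_or_ge_of_mem_axis {u : G} {e f : OrientedEdge G} (he : e ∈ axis u)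
    (hf : f ∈ axis u) : e < f ∨ f ≤ e := by
  rcases trichotomy e f with h | h | h | h | h | h
  · exact Or.inr h.ge
  · rw [h, ← rev_mem_axis_inv, rev_rev, mem_axis, ← smul_lt_smul (g := u), smul_inv_smul] at he
    exact (he.asymm hf).elim
  · exact Or.inl h
  · exact Or.inr h.le
  · exact (not_lt_rev_of_mem_axis he hf h).elim
  · exact (not_lt_rev_of_mem_axis (rev_mem_axis_inv.2 he) (rev_mem_axis_inv.2 hf)
      (by rwa [rev_rev])).elim

/-- An axis is convex: an edge lying in one fundamental segment precedes its own translate. -/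
theorem mem_axis_of_le_of_lt_pow {u : G} {a e : OrientedEdge G} (ha : a ∈ axis u) (hae : a ≤ e)
    (n : ℕ) (h : e < u ^ n • a) : e ∈ axis u := by
  induction n with
  | zero =>
    rw [pow_zero, one_smul] at h
    exact (hae.trans_lt h).false.elim
  | succ n ih =>
    rcases comparable hae (le_pow_smul ha n) h.le (pow_smul_lt_succ ha n).le with h' | h'
    · exact ih h'
    · refine h.trans_le ?_
      rw [pow_succ', mul_smul]
      exact smul_le_smul.2 h'

theorem exists_le_pow_smul {u : G} {a b : OrientedEdge G} (ha : a ∈ axis u) (hb : b ∈ axis u) :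
    ∃ n : ℕ, b ≤ u ^ n • a := by
  obtain ⟨n, hn⟩ := exists_not_pow_smul_lt ha b
  exact ⟨n, (lt_or_ge_of_mem_axis (pow_smul_mem_axis ha n) hb).resolve_left hn⟩

theorem mem_axis_of_le_of_lt {u : G} {a b e : OrientedEdge G} (ha : a ∈ axis u) (hb : b ∈ axis u)
    (hae : a ≤ e) (heb : e < b) : e ∈ axis u := by
  obtain ⟨n, hn⟩ := exists_le_pow_smul ha hb
  exact mem_axis_of_le_of_lt_pow ha hae n (heb.trans_le hn)

/-- An axis that contains another one is equal to it. -/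
theorem axis_subset_of_subset {u w : G} {m : OrientedEdge G} (hm : m ∈ axis u)
    (h : axis u ⊆ axis w) : axis w ⊆ axis u := by
  intro e he
  have hlow : ∃ a ∈ axis u, a ≤ e := by
    have hm' := rev_mem_axis_inv.2 hm
    obtain ⟨n, hn⟩ := exists_not_pow_smul_lt hm' e.rev
    have ha : u⁻¹ ^ n • m ∈ axis u := by simpa using zpow_smul_mem_axis hm (-n)
    rw [smul_rev, rev_lt_rev] at hn
    exact ⟨_, ha, (lt_or_ge_of_mem_axis he (h ha)).resolve_left hn⟩
  obtain ⟨a, ha, hae⟩ := hlow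
  obtain ⟨n, hn⟩ := exists_not_pow_smul_lt ha e
  have hb := pow_smul_mem_axis ha n
  rcases lt_or_ge_of_mem_axis he (h hb) with h' | h'
  · exact mem_axis_of_le_of_lt ha hb hae h'
  · rw [(h'.eq_of_not_lt hn).symm]
    exact hb

/-! ### Pairs of hyperbolic elements with different axes -/

/-- Take the last translate of `f` before `e`. The next one neither precedes `e` nor lies beyond it,
so it branches away from `e`. -/
theorem exists_gap_of_lt {g : G} {e f : OrientedEdge G} (hf : f ∈ axis g) (he : e ∉ axis g)
    (he' : e.rev ∉ axis g) (h : f < e) :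
    ∃ n : ℕ, g ^ n • f < e ∧ (g ^ (n + 1) • f).rev < e := by
  classical
  have hex := exists_not_pow_smul_lt hf e
  obtain ⟨n, hn⟩ : ∃ n, Nat.find hex = n + 1 :=
    Nat.exists_eq_succ_of_ne_zero fun h0 => Nat.find_spec hex (by rw [h0]; simpa using h)
  have hlt : g ^ n • f < e := not_not.1 (Nat.find_min hex (m := n) (by omega))
  have hnot : ¬ g ^ (n + 1) • f < e := hn ▸ Nat.find_spec hex
  have hF := pow_smul_mem_axis hf (n + 1)
  have hfF := pow_smul_lt_succ hf n
  refine ⟨n, hlt, ?_⟩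
  rcases trichotomy e (g ^ (n + 1) • f) with h | h | h | h | h | h
  · exact (he (h ▸ hF)).elim
  · exact (he' (by rw [h, rev_rev]; exact hF)).elim
  · refine (he (h.trans ?_)).elim
    rw [pow_succ', mul_smul]
    exact smul_lt_smul.2 hlt
  · exact (hnot h).elim
  · exact (not_le_and_le_rev hfF.le (hlt.trans h).le).elim
  · exact rev_lt.1 h

/-- The edge `E` points away from the axis of `g`, leaving it between two consecutive translates of
the edge `f`. -/
def LeavesAxis (g : G) (f E : OrientedEdge G) : Prop :=
  ∃ n : ℤ, g ^ n • f < E ∧ (g ^ (n + 1) • f).rev < E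

theorem leavesAxis_of_lt {g : G} {e f : OrientedEdge G} (hf : f ∈ axis g) (he : e ∉ axis g)
    (he' : e.rev ∉ axis g) (h : f < e ∨ f.rev < e) : LeavesAxis g f e := by
  rcases h with h | h
  · obtain ⟨n, h1, h2⟩ := exists_gap_of_lt hf he he' h
    exact ⟨n, by simpa using h1, by exact_mod_cast h2⟩
  · obtain ⟨n, h1, h2⟩ := exists_gap_of_lt (rev_mem_axis_inv.2 hf)
      (by rwa [mem_axis_inv]) (by rwa [rev_mem_axis_inv]) h
    have e1 : g ^ (-(n + 1 : ℕ) : ℤ) = g⁻¹ ^ (n + 1) := by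
      rw [zpow_neg, zpow_natCast, inv_pow]
    have e2 : g ^ (-(n + 1 : ℕ) + 1 : ℤ) = g⁻¹ ^ n := by
      rw [show (-(n + 1 : ℕ) + 1 : ℤ) = -(n : ℤ) by push_cast; ring]
      simp
    refine ⟨-(n + 1 : ℕ), ?_, ?_⟩
    · rw [smul_rev, rev_rev] at h2
      rwa [e1]
    · rwa [e2]

theorem leavesAxis_or {g : G} {e f : OrientedEdge G} (hf : f ∈ axis g) (he : e ∉ axis g)
    (he' : e.rev ∉ axis g) : LeavesAxis g f e ∨ LeavesAxis g f e.rev := by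
  have key := leavesAxis_of_lt hf he he'
  have key' := leavesAxis_of_lt hf he' (by rwa [rev_rev])
  rcases trichotomy e f with h | h | h | h | h | h
  · exact (he (h ▸ hf)).elim
  · exact (he' (by rw [h, rev_rev]; exact hf)).elim
  · exact Or.inr (key' (Or.inr (rev_lt_rev.2 h)))
  · exact Or.inl (key (Or.inl h))
  · exact Or.inr (key' (Or.inl (lt_rev.1 h)))
  · exact Or.inl (key (Or.inr (rev_lt.1 h)))

theorem LeavesAxis.lt_or {g : G} {e f : OrientedEdge G} (hf : f ∈ axis g)
    (h : LeavesAxis g f e) : f < e ∨ f.rev < e := by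
  obtain ⟨n, h1, h2⟩ := h
  rcases le_or_gt 0 n with hn | hn
  · lift n to ℕ using hn
    rw [zpow_natCast] at h1
    exact Or.inl ((le_pow_smul hf n).trans_lt h1)
  · obtain ⟨k, hk⟩ := Int.eq_ofNat_of_zero_le (show 0 ≤ -(n + 1) by omega)
    have h3 := le_pow_smul (rev_mem_axis_inv.2 hf) k
    refine Or.inr (h3.trans_lt ?_)
    have h4 : g ^ (n + 1) = g⁻¹ ^ k := by
      rw [inv_pow, ← zpow_natCast, ← hk, zpow_neg, inv_inv]
    rwa [smul_rev, ← h4]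

/-- Going backwards along the axis of `h`, the edges cannot leave the axis of `g` for ever: by
`LeavesAxis.lt_or` they would all lie beyond `f` or `f.rev`. -/
theorem exists_first_leavesAxis {g h : G} {e f : OrientedEdge G} (hf : f ∈ axis g)
    (he : e ∈ axis h) (hl : LeavesAxis g f e) :
    ∃ E ∈ axis h, LeavesAxis g f E ∧ ¬ LeavesAxis g f (h⁻¹ • E) := by
  by_contra! hcon
  have all : ∀ k : ℕ, h⁻¹ ^ k • e ∈ axis h ∧ LeavesAxis g f (h⁻¹ ^ k • e) := by
    intro k
    have hk : h⁻¹ ^ k • e ∈ axis h := by simpa using zpow_smul_mem_axis he (-k)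
    refine ⟨hk, ?_⟩
    induction k with
    | zero => simpa using hl
    | succ k ih =>
      have hk' : h⁻¹ ^ k • e ∈ axis h := by simpa using zpow_smul_mem_axis he (-k)
      rw [pow_succ', mul_smul]
      exact hcon _ hk' (ih hk')
  have he' := rev_mem_axis_inv.2 he
  obtain ⟨m, hm⟩ := exists_not_pow_smul_lt he' f
  obtain ⟨n, hn⟩ := exists_not_pow_smul_lt he' f.rev
  have hmono := pow_smul_mono he'
  rcases (all (max m n)).2.lt_or hf with h' | h'
  · exact hn ((hmono (le_max_right m n)).trans_lt (by
      change _ • e.rev < _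
      rwa [smul_rev, rev_lt_rev]))
  · exact hm ((hmono (le_max_left m n)).trans_lt (by
      change _ • e.rev < _
      rwa [smul_rev, rev_lt]))

/-- Let `E` be the first edge in its orbit under `h` that leaves the axis of `g`, say between `x`
and `g • x`. Its predecessor `h⁻¹ • E` is not in this gap. If it precedes `g • x`, the half-trees at
`E` and `g • x` serve for `h` and `g`; if it precedes `x.rev`, those at `E` and `x.rev` serve for
`h` and `g⁻¹`. -/
theorem LeavesAxis.pingPong {g h : G} {e f : OrientedEdge G} (hf : f ∈ axis g)
    (he : e ∈ axis h) (hl : LeavesAxis g f e) : PingPong h g ∨ PingPong h g⁻¹ := by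
  obtain ⟨E, hE, ⟨n, h1, h2⟩, hnot⟩ := exists_first_leavesAxis hf he hl
  have hx := zpow_smul_mem_axis hf n
  have hyx : g ^ (n + 1) • f = g • g ^ n • f := by rw [smul_smul, ← zpow_one_add, add_comm]
  rw [hyx] at h2
  have hnot' : g ^ n • f < h⁻¹ • E → ¬ (g • g ^ n • f).rev < h⁻¹ • E := fun h3 h4 =>
    hnot ⟨n, h3, by rwa [hyx]⟩
  generalize g ^ n • f = x at h1 h2 hx hnot'
  have hxy : x < g • x := hx
  have hpast : h⁻¹ • E < E := by
    rw [← smul_lt_smul (g := h), smul_inv_smul]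
    exact hE
  have first : h⁻¹ • E ≤ g • x → PingPong h g := fun h0 =>
    pingPong_of_le hE.le (smul_le_smul.2 hxy.le) (rev_lt.1 h2).le
      (by rwa [← smul_le_smul (g := h), smul_inv_smul] at h0) (smul_le_smul.2 h1.le)
  have second : h⁻¹ • E ≤ x.rev → PingPong h g⁻¹ := fun h0 =>
    pingPong_of_le (F := x.rev) hE.le
      (by rw [← smul_le_smul (g := g), smul_inv_smul, smul_rev, rev_le_rev]; exact hxy.le)
      (by rw [rev_le_rev]; exact h1.le)
      (by rwa [← smul_le_smul (g := h), smul_inv_smul] at h0)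
      (by rw [← smul_le_smul (g := g), smul_inv_smul]; exact h2.le)
  have hrev : (g • x).rev < x.rev := rev_lt_rev.2 hxy
  rcases trichotomy (h⁻¹ • E) (g • x) with h0 | h0 | h0 | h0 | h0 | h0
  · exact Or.inl (first h0.le)
  · exact Or.inr (second (h0.le.trans hrev.le))
  · exact Or.inl (first h0.le)
  · exact (not_le_and_rev_le (h0.trans hpast).le h2.le).elim
  · exact Or.inr (second (h0.trans hrev).le)
  have h0' := rev_lt.1 h0
  rcases trichotomy (h⁻¹ • E) x with h3 | h3 | h3 | h3 | h3 | h3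
  · exact (not_le_and_le_rev hrev.le (by rw [rev_rev]; exact h0'.le.trans h3.le)).elim
  · exact Or.inr (second h3.le)
  · exact (not_le_and_le_rev hrev.le (by rw [rev_rev]; exact (h0'.trans h3).le)).elim
  · exact (hnot' h3 h0').elim
  · exact Or.inr (second h3.le)
  · exact (not_le_and_rev_le h1.le ((rev_lt.1 h3).trans hpast).le).elim

/-- Two hyperbolic elements with different axes generate a free monoid, up to inverting them. -/
theorem exists_pingPong {g h : G} {e f : OrientedEdge G} (hf : f ∈ axis g)
    (he : e ∈ axis h) (hoff : e ∉ axis g) (hoff' : e.rev ∉ axis g) :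
    (PingPong h g ∨ PingPong h g⁻¹) ∨ PingPong h⁻¹ g ∨ PingPong h⁻¹ g⁻¹ := by
  rcases leavesAxis_or hf hoff hoff' with hl | hl
  · exact Or.inl (hl.pingPong hf he)
  · exact Or.inr (hl.pingPong hf (rev_mem_axis_inv.2 he))

/-- The edges `x`, `y` lie on the axes of `u`, `v` and both precede `u • x` and `v • y`. -/
structure Coherent (u v : G) (x y : OrientedEdge G) : Prop where
  left : x < u • x
  left_right : x < v • y
  right_left : y < u • x
  right : y < v • y

theorem Coherent.symm {u v : G} {x y : OrientedEdge G} (h : Coherent u v x y) :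
    Coherent v u y x := ⟨h.right, h.right_left, h.left_right, h.left⟩

theorem Coherent.rev {u v : G} {x y : OrientedEdge G} (h : Coherent u v x y) :
    Coherent u⁻¹ v⁻¹ (u • x).rev (v • y).rev := by
  constructor <;> rw [smul_rev, inv_smul_smul, rev_lt_rev]
  exacts [h.left, h.right_left, h.left_right, h.right]

/-- Whichever of `u • x` and `v • y` comes first replaces its predecessor. If the two diverge
instead, the half-trees beyond them give ping-pong. -/
theorem Coherent.advance {u v : G} {x y : OrientedEdge G} (h : Coherent u v x y)
    (hpp : ¬ PingPong u v) :
    Coherent u v (u • x) y ∨ Coherent u v x (v • y) ∨ Coherent u v (u • x) (v • y) := by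
  have hx : u • x < u • u • x := smul_lt_smul.2 h.left
  have hy : v • y < v • v • y := smul_lt_smul.2 h.right
  rcases trichotomy (u • x) (v • y) with h0 | h0 | h0 | h0 | h0 | h0
  · exact Or.inr (Or.inr ⟨hx, h0 ▸ hy, h0 ▸ hx, hy⟩)
  · exact (not_le_and_le_rev h.left_right.le (h0 ▸ h.left.le)).elim
  · exact Or.inl ⟨hx, h0, h.right_left.trans hx, h.right⟩
  · exact Or.inr (Or.inl ⟨h.left, h.left_right.trans hy, h0, hy⟩)
  · exact (not_le_and_le_rev h.left_right.le (h.left.trans h0).le).elim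
  · exact (hpp (pingPong_of_le hx.le hy.le h0.le (smul_le_smul.2 h.left_right.le)
      (smul_le_smul.2 h.right_left.le))).elim

theorem Coherent.exists_add {u v : G} {x y : OrientedEdge G} (h : Coherent u v x y)
    (hpp : ¬ PingPong u v) (N : ℕ) :
    ∃ a b : ℕ, N ≤ a + b ∧ Coherent u v (u ^ a • x) (v ^ b • y) := by
  induction N with
  | zero => exact ⟨0, 0, le_rfl, by simpa using h⟩
  | succ N ih =>
    obtain ⟨a, b, hab, hc⟩ := ih
    rcases hc.advance hpp with h' | h' | h'
    · exact ⟨a + 1, b, by omega, by rwa [pow_succ', mul_smul]⟩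
    · exact ⟨a, b + 1, by omega, by rwa [pow_succ', mul_smul]⟩
    · exact ⟨a + 1, b + 1, by omega, by rwa [pow_succ', mul_smul, pow_succ', mul_smul]⟩

/-- Repeated advances move both edges along: the exponent of `u` cannot stay below `n`, since then
the translates of `y` would remain below a fixed edge. -/
theorem Coherent.exists_pow_lt {u v : G} {x y : OrientedEdge G} (h : Coherent u v x y)
    (hpp : ¬ PingPong u v) (n : ℕ) : ∃ m : ℕ, u ^ n • x < v ^ m • y := by
  have hx : x ∈ axis u := h.left
  have hy : y ∈ axis v := h.right
  obtain ⟨k, hk⟩ := exists_not_pow_smul_lt hy (u ^ n • x)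
  obtain ⟨a, b, hab, hc⟩ := h.exists_add hpp (n + k)
  have han : n ≤ a := by
    by_contra! han
    refine hk ((pow_smul_mono hy (by omega : k ≤ b)).trans_lt (hc.right_left.trans_le ?_))
    rw [smul_smul, ← pow_succ']
    exact pow_smul_mono hx (by omega)
  refine ⟨b + 1, (pow_smul_mono hx han).trans_lt ?_⟩
  rw [pow_succ', mul_smul]
  exact hc.left_right

/-- If the axes of `u` and `v` run in the same direction at some place and `u`, `v` do not generate
a free monoid then they have the same axis. -/
theorem Coherent.axis_subset {u v : G} {x y : OrientedEdge G} (h : Coherent u v x y)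
    (hpp : ¬ PingPong u v) (hpp' : ¬ PingPong u⁻¹ v⁻¹) : axis u ⊆ axis v := by
  intro e he
  obtain ⟨n, hn⟩ := exists_le_pow_smul (u := u) h.left he
  obtain ⟨m, hm⟩ := h.exists_pow_lt hpp n
  obtain ⟨n', hn'⟩ := exists_le_pow_smul (u := u⁻¹) h.rev.left (rev_mem_axis_inv.2 he)
  obtain ⟨m', hm'⟩ := h.rev.exists_pow_lt hpp' n'
  have hlow := hn'.trans_lt hm'
  rw [smul_rev, rev_lt_rev] at hlow
  have hy : v • y ∈ axis v := by simpa using pow_smul_mem_axis (u := v) h.right 1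
  have ha : v⁻¹ ^ m' • v • y ∈ axis v := by simpa using zpow_smul_mem_axis hy (-m')
  refine mem_axis_of_le_of_lt ha (pow_smul_mem_axis (u := v) h.right m) hlow.le (hn.trans_lt hm)

/-! ### Groups preserving an axis -/

/-- The unoriented axis of `h` is mapped into itself by `s`. -/
def PreservesAxis (h s : G) : Prop :=
  ∀ e, e ∈ axis h ∨ e.rev ∈ axis h → s • e ∈ axis h ∨ (s • e).rev ∈ axis h

theorem preservesAxis_of_forall {h s : G}
    (H : ∀ e ∈ axis h, s • e ∈ axis h ∨ (s • e).rev ∈ axis h) : PreservesAxis h s := by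
  rintro e (he | he)
  · exact H e he
  · have := H _ he
    rw [smul_rev, rev_rev] at this
    exact this.symm

theorem lt_of_mem_axis_of_lt {w : G} {a b : OrientedEdge G} (ha : a ∈ axis w)
    (hb : b ∈ axis w ∨ b.rev ∈ axis w) (hab : a < b) : b ∈ axis w := by
  refine hb.resolve_right fun hb => ?_
  rcases lt_or_ge_of_mem_axis ha hb with h | h
  · exact not_le_and_le_rev hab.le h.le
  · exact not_rev_le _ (h.trans hab.le)

/-- The axis is invariant under all of G, hence is the whole tree. Two different nontrivial elements
`k`, `l` of a factor would give three edges 1, `k`, `l` at one vertex of a line. -/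
theorem factor_subsingleton_of_preservesAxis {S : Finset G}
    (hS : Subgroup.closure (S : Set G) = ⊤) {h : G} {e : OrientedEdge G} (he : e ∈ axis h)
    (hp : ∀ s, IsLetter S s → PreservesAxis h s) (i : Bool) {k l : G} (hk : k ∈ factor i)
    (hl : l ∈ factor i) (hk1 : k ≠ 1) (hl1 : l ≠ 1) : k = l := by
  have hall : ∀ s : G, PreservesAxis h s := by
    intro s
    have hs : s ∈ Subgroup.closure (S : Set G) := by rw [hS]; trivial
    rw [← Subgroup.mem_toSubmonoid, Subgroup.closure_toSubmonoid] at hs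
    induction hs using Submonoid.closure_induction with
    | mem s hs => exact hp s (by simpa [IsLetter] using hs)
    | one => intro e he; simpa using he
    | mul s t _ _ ihs iht =>
      intro e he
      rw [mul_smul]
      exact ihs _ (iht e he)
  -- G is transitive on unoriented edges.
  have hmem : ∀ f : OrientedEdge G, f ∈ axis h ∨ f.rev ∈ axis h := by
    intro f
    have h1 := hall (f.base * e.base⁻¹) e (Or.inl he)
    rcases eq_or_ne e.dir f.dir with hd | hd
    · have : f = (f.base * e.base⁻¹) • e := OrientedEdge.ext (by simp) (by simp [hd])
      rwa [this]
    · have : f.rev = (f.base * e.base⁻¹) • e :=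
        OrientedEdge.ext (by simp) (by simpa [eq_comm, ← Bool.eq_not] using hd)
      rw [← this, rev_rev] at h1
      exact h1.symm
  by_contra hkl
  have hside : ∀ x ∈ factor (G := G) i, x ≠ 1 → side x = some i := side_of_mem i
  have hab : ∀ x ∈ factor (G := G) i, x ≠ 1 → (⟨1, i⟩ : OrientedEdge G) < ⟨x, !i⟩ := by
    intro x hx hx1
    rw [lt_def]
    simp only [inv_one, one_mul, mul_one, Bool.not_not]
    exact ⟨hside x hx hx1, hside _ (inv_mem hx) (inv_ne_one.2 hx1)⟩
  have hbc : (⟨k, !i⟩ : OrientedEdge G).rev < ⟨l, !i⟩ := by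
    rw [lt_def]
    simp only [rev_base, rev_dir, Bool.not_not]
    refine ⟨hside _ (mul_mem (inv_mem hk) hl) ?_, hside _ (mul_mem (inv_mem hl) hk) ?_⟩
    · rwa [ne_eq, inv_mul_eq_one]
    · rw [ne_eq, inv_mul_eq_one]; exact fun h => hkl h.symm
  -- Replacing `h` by its inverse if necessary makes the first of the three edges run forwards.
  obtain ⟨w, hw, hw'⟩ : ∃ w : G, (⟨1, i⟩ : OrientedEdge G) ∈ axis w ∧
      ∀ f : OrientedEdge G, f ∈ axis w ∨ f.rev ∈ axis w := by
    rcases hmem ⟨1, i⟩ with h1 | h1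
    · exact ⟨h, h1, hmem⟩
    · refine ⟨h⁻¹, mem_axis_inv.2 h1, fun f => ?_⟩
      rw [mem_axis_inv, rev_mem_axis_inv]
      exact (hmem f).symm
  have hb := lt_of_mem_axis_of_lt hw (hw' _) (hab k hk hk1)
  have hc := lt_of_mem_axis_of_lt hw (hw' _) (hab l hl hl1)
  rcases lt_or_ge_of_mem_axis hb hc with h0 | h0
  · exact not_le_and_rev_le h0.le hbc.le
  · exact not_rev_le _ (hbc.le.trans h0)

/-- Generating sets that contain a hyperbolic element. -/
theorem goldenRatio_le_of_mem_axis {S : Finset G} (hS : Subgroup.closure (S : Set G) = ⊤) {h : G}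
    (hh : IsLetter S h) {e : OrientedEdge G} (he : e ∈ axis h) :
    Real.goldenRatio ≤ expGrowthRate S ∨
      ∀ i, ∀ k ∈ factor (G := G) i, ∀ l ∈ factor (G := G) i, k ≠ 1 → l ≠ 1 → k = l := by
  by_cases hp : ∀ s, IsLetter S s → PreservesAxis h s
  · exact Or.inr fun i k hk l hl hk1 hl1 =>
      factor_subsingleton_of_preservesAxis hS he hp i hk hl hk1 hl1
  left
  push Not at hp
  obtain ⟨s, hs, hsp⟩ := hp
  have hsp' := mt preservesAxis_of_forall hsp
  push Not at hsp'
  obtain ⟨f, hf, h1, h2⟩ := hsp'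
  have hinv : (s * h * s⁻¹)⁻¹ = s * h⁻¹ * s⁻¹ := by group
  rcases exists_pingPong he (smul_mem_axis_conj s hf) h1 h2 with (h | h) | h | h
  · exact h.symm.goldenRatio_le_of_conj hS hh hh hs
  · exact h.symm.goldenRatio_le_of_conj hS hh.inv hh hs
  · rw [hinv] at h; exact h.symm.goldenRatio_le_of_conj hS hh hh.inv hs
  · rw [hinv] at h; exact h.symm.goldenRatio_le_of_conj hS hh.inv hh.inv hs

end FreeSplitting

namespace FreeSplitting

open OrientedEdge

variable {G : Type*} [Group G] [FreeSplitting G]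

/-! ### Vertex groups -/

theorem side_inv_of_mem {i : Bool} {a : G} (ha : a ∈ factor i) (ha1 : a ≠ 1) :
    side a⁻¹ = some i :=
  side_of_mem i _ (inv_mem ha) (inv_ne_one.2 ha1)

/-- The stabilizers of the vertices of the Bass-Serre tree. -/
def IsVertexGroup (K : Subgroup G) : Prop :=
  ∃ (g : G) (i : Bool), ∀ x, x ∈ K ↔ g⁻¹ * x * g ∈ factor i

theorem isVertexGroup_factor (i : Bool) : IsVertexGroup (factor (G := G) i) :=
  ⟨1, i, by simp⟩

theorem IsVertexGroup.exists_ne_one {K : Subgroup G} (hK : IsVertexGroup K) :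
    ∃ k ∈ K, k ≠ 1 := by
  obtain ⟨g, i, h⟩ := hK
  obtain ⟨k, hk, hk1⟩ := factor_nontrivial (G := G) i
  exact ⟨g * k * g⁻¹, (h _).2 (by simpa [mul_assoc] using hk), by simpa using hk1⟩

theorem IsVertexGroup.ne_top {K : Subgroup G} (hK : IsVertexGroup K) : K ≠ ⊤ := by
  rintro rfl
  obtain ⟨g, i, h⟩ := hK
  obtain ⟨k, hk, hk1⟩ := factor_nontrivial (G := G) (!i)
  have h1 := (h (g * k * g⁻¹)).1 trivial
  have h2 : g⁻¹ * (g * k * g⁻¹) * g = k := by group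
  rw [h2] at h1
  have h3 := side_of_mem _ k h1 hk1
  rw [side_of_mem _ k hk hk1] at h3
  simp at h3

/-- The oriented edge `e` points to the vertex stabilized by `K`. -/
def PointsTo (K : Subgroup G) (e : OrientedEdge G) : Prop :=
  ∀ k ∈ K, k ≠ 1 → e < (k • e).rev

/-- A vertex lies on one definite side of an edge. A leading syllable of `y` in the factor `i`
merely conjugates that factor, so it may be dropped. -/
theorem exists_side_conj (i : Bool) (y : G) :
    ∃ j, ∀ k ∈ factor (G := G) i, k ≠ 1 → side (y⁻¹ * k * y) = some j := by
  have key : ∀ y : G, side y ≠ some i →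
      ∃ j, ∀ k ∈ factor (G := G) i, k ≠ 1 → side (y⁻¹ * k * y) = some j := by
    intro y hy
    rcases eq_or_ne y 1 with rfl | hy1
    · exact ⟨i, fun k hk hk1 => by simpa using side_of_mem i k hk hk1⟩
    obtain ⟨j, hj⟩ := exists_side (inv_ne_one.2 hy1)
    obtain ⟨l, hl⟩ := exists_side hy1
    refine ⟨j, fun k hk hk1 => ?_⟩
    rw [mul_assoc]
    refine side_mul_of_ne hj (by rw [inv_inv, hl]) ?_
    rw [side_mul_of_ne (side_of_mem i k hk hk1) (side_inv_of_mem hk hk1) hy, ← hl]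
    exact hy.symm
  by_cases hy : side y = some i
  · obtain ⟨a, ha, -, z, rfl, hz⟩ := exists_factor y i hy
    obtain ⟨j, hj⟩ := key z hz
    refine ⟨j, fun k hk hk1 => ?_⟩
    have e1 : (a * z)⁻¹ * k * (a * z) = z⁻¹ * (a⁻¹ * k * a) * z := by group
    rw [e1]
    refine hj _ (mul_mem (mul_mem (inv_mem ha) hk) ha) fun h => hk1 ?_
    have : k = a * (a⁻¹ * k * a) * a⁻¹ := by group
    rw [this, h]
    simp
  · exact key y hy

theorem lt_smul_rev {k : G} {e : OrientedEdge G} :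
    e < (k • e).rev ↔ side (e.base⁻¹ * k * e.base) = some e.dir ∧
      side (e.base⁻¹ * k⁻¹ * e.base) = some e.dir := by
  simp [lt_def, mul_assoc]

theorem IsVertexGroup.pointsTo_or {K : Subgroup G} (hK : IsVertexGroup K) (e : OrientedEdge G) :
    PointsTo K e ∨ PointsTo K e.rev := by
  obtain ⟨g, i, h⟩ := hK
  obtain ⟨j, hj⟩ := exists_side_conj i (g⁻¹ * e.base)
  have key : ∀ k ∈ K, k ≠ 1 → side (e.base⁻¹ * k * e.base) = some j := by
    intro k hk hk1
    rw [← hj _ ((h k).1 hk)]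
    · congr 1; group
    · intro h0
      refine hk1 ?_
      have : k = g * (g⁻¹ * k * g) * g⁻¹ := by group
      rw [this, h0]
      simp
  rcases eq_or_ne j e.dir with rfl | hd
  · exact Or.inl fun k hk hk1 => lt_smul_rev.2 ⟨key k hk hk1, key _ (inv_mem hk) (inv_ne_one.2 hk1)⟩
  · obtain rfl : j = !e.dir := by simpa [← Bool.eq_not] using hd
    exact Or.inr fun k hk hk1 => lt_smul_rev.2 ⟨key k hk hk1, key _ (inv_mem hk) (inv_ne_one.2 hk1)⟩

theorem IsVertexGroup.not_pointsTo_rev {K : Subgroup G} (hK : IsVertexGroup K)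
    {e : OrientedEdge G} (h : PointsTo K e) (h' : PointsTo K e.rev) : False := by
  obtain ⟨k, hk, hk1⟩ := hK.exists_ne_one
  have h1 := h' k hk hk1
  rw [smul_rev, rev_lt_rev] at h1
  exact h1.asymm (h k hk hk1)

theorem PointsTo.of_le {K : Subgroup G} {e f : OrientedEdge G} (h : PointsTo K e) (hfe : f ≤ e) :
    PointsTo K f := fun k hk hk1 =>
  hfe.trans_lt ((h k hk hk1).trans_le (rev_le_rev.2 (smul_le_smul.2 hfe)))

theorem PointsTo.smul {K : Subgroup G} {e : OrientedEdge G} (h : PointsTo K e) {k : G}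
    (hk : k ∈ K) : PointsTo K (k • e) := by
  intro l hl hl1
  have h1 := h (k⁻¹ * l * k) (mul_mem (mul_mem (inv_mem hk) hl) hk) fun h0 => hl1 (by
    have : l = k * (k⁻¹ * l * k) * k⁻¹ := by group
    rw [this, h0]
    simp)
  rw [← smul_lt_smul (g := k), smul_rev, smul_smul] at h1
  rwa [smul_smul, show l * k = k * (k⁻¹ * l * k) by group]

/-- All edges at the vertex of `K`, directed to it, point to that of `L`. So a nontrivial `t` in
`L`, moved to the standard vertex, begins with a syllable in factor `i` after conjugation by any `k`
in that factor. Taking for `k` its own first syllable leaves room for no further syllables. -/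
theorem IsVertexGroup.le_of_forall {K L : Subgroup G} (hK : IsVertexGroup K)
    (h : ∀ e, PointsTo K e → PointsTo L e) : L ≤ K := by
  obtain ⟨g, i, hg⟩ := hK
  intro t ht
  rw [hg]
  rcases eq_or_ne t 1 with rfl | ht1
  · simp
  have key : ∀ k ∈ factor (G := G) i, side (k⁻¹ * (g⁻¹ * t * g) * k) = some i := by
    intro k hk
    have hp : PointsTo K ⟨g * k, i⟩ := by
      intro l hl hl1
      have hl' := mul_mem (mul_mem (inv_mem hk) ((hg l).1 hl)) hk
      have e1 : (g * k)⁻¹ * l * (g * k) = k⁻¹ * (g⁻¹ * l * g) * k := by group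
      have e2 : (g * k)⁻¹ * l⁻¹ * (g * k) = (k⁻¹ * (g⁻¹ * l * g) * k)⁻¹ := by group
      have hne : k⁻¹ * (g⁻¹ * l * g) * k ≠ 1 := by
        rw [← e1]
        intro h0
        refine hl1 ?_
        have : l = (g * k) * ((g * k)⁻¹ * l * (g * k)) * (g * k)⁻¹ := by group
        rw [this, h0]
        simp
      rw [lt_smul_rev, e1, e2]
      exact ⟨side_of_mem i _ hl' hne, side_inv_of_mem hl' hne⟩
    have := (lt_smul_rev.1 (h _ hp t ht ht1)).1
    rwa [show (g * k)⁻¹ * t * (g * k) = k⁻¹ * (g⁻¹ * t * g) * k by group] at this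
  generalize g⁻¹ * t * g = w at key
  have hw : side w = some i := by simpa using key 1 (one_mem _)
  obtain ⟨a, ha, ha1, w', rfl, hw'⟩ := exists_factor w i hw
  have h1 := key a ha
  rw [inv_mul_cancel_left] at h1
  rcases eq_or_ne w' 1 with rfl | hw1
  · simpa using ha
  exfalso
  refine hw' (Eq.trans ?_ h1)
  obtain ⟨j, hj⟩ := exists_side (inv_ne_one.2 hw1)
  obtain ⟨l, hl⟩ := exists_side hw1
  rw [hl]
  rcases eq_or_ne j i with rfl | hji
  · obtain ⟨b, hb, -, v, hv, hvj⟩ := exists_factor _ j hj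
    have hv' : w' = v⁻¹ * b⁻¹ := by rw [← mul_inv_rev, ← hv, inv_inv]
    have hv1 : v ≠ 1 := by
      rintro rfl
      refine hw' ?_
      rw [hv', inv_one, one_mul]
      exact side_inv_of_mem hb fun hb1 => hw1 (by rw [hv', hb1]; simp)
    obtain ⟨m, hm⟩ := exists_side (inv_ne_one.2 hv1)
    have hfac : ∀ c ∈ factor (G := G) j, side (v⁻¹ * c) = some m := by
      intro c hc
      obtain ⟨n, hn⟩ := exists_side hv1
      refine side_mul_of_ne hm (by rw [inv_inv, hn]) ?_
      rcases eq_or_ne c 1 with rfl | hc1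
      · simp
      · rw [side_of_mem j c hc hc1, ← hn]
        exact hvj.symm
    rw [← hl, hv', hfac _ (inv_mem hb), mul_assoc, hfac _ (mul_mem (inv_mem hb) ha)]
  · exact (side_mul_of_ne hl hj (by rw [side_of_mem i a ha ha1]; simpa using hji.symm)).symm

theorem IsVertexGroup.exists_separating {K L : Subgroup G} (hK : IsVertexGroup K)
    (hL : IsVertexGroup L) (hne : K ≠ L) : ∃ e, PointsTo K e ∧ PointsTo L e.rev := by
  by_contra! h
  have h1 : ∀ e, PointsTo K e → PointsTo L e := fun e he => (hL.pointsTo_or e).resolve_right (h e he)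
  refine hne (le_antisymm (hL.le_of_forall fun e he => ?_) (hK.le_of_forall h1))
  exact (hK.pointsTo_or e).resolve_right fun he' => hL.not_pointsTo_rev he (h1 _ he')

/-- An element without axis fixes a vertex. -/
theorem exists_isVertexGroup_of_axis_eq_empty {s : G} (hs1 : s ≠ 1) (hs : axis s = ∅) :
    ∃ K : Subgroup G, IsVertexGroup K ∧ s ∈ K := by
  -- Choose a conjugate with the fewest syllables.
  obtain ⟨g, hg⟩ : ∃ g : G, ∀ h : G, len (g⁻¹ * s * g) ≤ len (h⁻¹ * s * h) := by
    obtain ⟨-, ⟨g, rfl⟩, h⟩ := wellFounded_lt.has_min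
      (Set.range fun g : G => len (g⁻¹ * s * g)) ⟨_, ⟨1, rfl⟩⟩
    exact ⟨g, fun x => not_lt.1 (h _ ⟨x, rfl⟩)⟩
  have hw1 : g⁻¹ * s * g ≠ 1 := fun h0 => hs1 (by
    have : s = g * (g⁻¹ * s * g) * g⁻¹ := by group
    rw [this, h0]
    simp)
  obtain ⟨i, hi⟩ := exists_side hw1
  -- If the conjugate began and ended in different factors, the edge `g` would lie on the axis of
  -- `s`.
  have hi' : side (g⁻¹ * s * g)⁻¹ = some i := by
    obtain ⟨j, hj⟩ := exists_side (inv_ne_one.2 hw1)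
    rcases eq_or_ne j i with rfl | hji
    · exact hj
    exfalso
    have : (⟨g, i⟩ : OrientedEdge G) ∈ axis s := by
      rw [mem_axis, lt_def]
      simp only [smul_base, smul_dir]
      refine ⟨by rwa [← mul_assoc], ?_⟩
      rw [show (s * g)⁻¹ * g = (g⁻¹ * s * g)⁻¹ by group, hj]
      simpa [Bool.eq_not] using hji
    rw [hs] at this
    exact this
  have hmin : ∀ a : G, len (g⁻¹ * s * g) ≤ len (a⁻¹ * (g⁻¹ * s * g) * a) := by
    intro a
    rw [show a⁻¹ * (g⁻¹ * s * g) * a = (g * a)⁻¹ * s * (g * a) by group]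
    exact hg _
  suffices g⁻¹ * s * g ∈ factor i by
    refine ⟨(factor i).map (MulAut.conj g).toMonoidHom, ⟨g, i, fun x => ?_⟩, ?_⟩
    · rw [Subgroup.mem_map]
      constructor
      · rintro ⟨y, hy, rfl⟩
        simpa [mul_assoc] using hy
      · exact fun hx => ⟨_, hx, by simp [mul_assoc]⟩
    · exact ⟨_, this, by simp [mul_assoc]⟩
  generalize g⁻¹ * s * g = w at *
  obtain ⟨a, ha, ha1, v, rfl, hv⟩ := exists_factor w i hi
  rcases eq_or_ne v 1 with rfl | hv1
  · simpa using ha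
  exfalso
  obtain ⟨j, hj⟩ := exists_side hv1
  obtain ⟨l, hl⟩ := exists_side (inv_ne_one.2 hv1)
  have hvl : l = i := by
    have h1 : side (v⁻¹ * a⁻¹) = some l := by
      refine side_mul_of_ne hl (by rw [inv_inv, hj]) ?_
      rw [side_inv_of_mem ha ha1, ← hj]
      exact hv.symm
    rw [mul_inv_rev, h1] at hi'
    exact Option.some_injective _ hi'
  subst hvl
  obtain ⟨b, hb, hb1, c, hc, hcl⟩ := exists_factor _ l hl
  have hc' : v = c⁻¹ * b⁻¹ := by rw [← mul_inv_rev, ← hc, inv_inv]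
  have hlen : ∀ d ∈ factor (G := G) l, len (c⁻¹ * d) ≤ len c⁻¹ + 1 := by
    intro d hd
    rcases eq_or_ne d 1 with rfl | hd1
    · simp
    · rw [len_mul, len_of_mem l d hd hd1]
      rw [inv_inv, side_of_mem l d hd hd1]
      exact hcl
  -- Conjugation by the first syllable `a` merges it with the last one `b⁻¹`, against minimality.
  have h1 := hmin a
  have h2 : a⁻¹ * (a * v) * a = c⁻¹ * (b⁻¹ * a) := by rw [hc']; group
  have h3 := hlen _ (mul_mem (inv_mem hb) ha)
  have h4 : len (a * v) = 1 + len v := by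
    rw [len_mul, len_of_mem l a ha ha1]
    rw [side_inv_of_mem ha ha1]
    exact hv.symm
  have h5 : len v = len c⁻¹ + 1 := by
    rw [hc', len_mul, len_of_mem l _ (inv_mem hb) (inv_ne_one.2 hb1)]
    rw [inv_inv, side_inv_of_mem hb hb1]
    exact hcl
  rw [h2] at h1
  omega

/-! ### Ping-pong with elements that fix vertices -/

open scoped Pointwise

theorem PointsTo.smul_half_subset {K : Subgroup G} {e : OrientedEdge G} (h : PointsTo K e) {k : G}
    (hk : k ∈ K) (hk1 : k ≠ 1) : k • half e.rev ⊆ half e := by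
  rw [smul_half]
  exact half_anti (h k hk hk1).le

theorem PointsTo.disjoint_smul_half {K : Subgroup G} {e : OrientedEdge G} (h : PointsTo K e)
    {k l : G} (hk : k ∈ K) (hl : l ∈ K) (hkl : k ≠ l) :
    Disjoint (k • half e.rev) (l • half e.rev) := by
  have h1 := h.smul_half_subset (mul_mem (inv_mem hk) hl) (by rwa [ne_eq, inv_mul_eq_one])
  have h2 := disjoint_smul_smul ((disjoint_half_rev e).symm.mono_right h1) k
  rwa [smul_smul, mul_inv_cancel_left] at h2

/-! ### Growth bounds from letters that fix vertices -/

section Letters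

variable {S : Finset G} (hS : Subgroup.closure (S : Set G) = ⊤)
include hS

/-- The three maps are `r * y₁`, `r * y₂`, `r * y₃` on the half-tree that contains the vertex of
`L`: the elements of `K` throw it to disjoint places on the other side and `r` brings these back. -/
theorem goldenRatio_le_of_three_mem {K L : Subgroup G} (hK : IsVertexGroup K)
    (hL : IsVertexGroup L) (hne : K ≠ L) {r y₁ y₂ y₃ : G} (hr : r ∈ L) (hr1 : r ≠ 1)
    (hrS : IsLetter S r) (h₁ : y₁ ∈ K) (h₂ : y₂ ∈ K) (h₃ : y₃ ∈ K) (h₁1 : y₁ ≠ 1) (h₂1 : y₂ ≠ 1)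
    (h₃1 : y₃ ≠ 1) (h₁₂ : y₁ ≠ y₂) (h₁₃ : y₁ ≠ y₃) (h₂₃ : y₂ ≠ y₃) (l₁ : IsLetter S y₁)
    (l₂ : IsLetter S y₂) (l₃ : wordLength S y₃ ≤ 2) : Real.goldenRatio ≤ expGrowthRate S := by
  obtain ⟨e, he, he'⟩ := hK.exists_separating hL hne
  have hsub : ∀ y ∈ K, y ≠ 1 → (r * y) • half e.rev ⊆ half e.rev := by
    intro y hy hy1
    rw [mul_smul]
    have h1 := he'.smul_half_subset hr hr1
    rw [rev_rev] at h1
    exact (Set.smul_set_mono (he.smul_half_subset hy hy1)).trans h1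
  have hdis : ∀ y ∈ K, ∀ z ∈ K, y ≠ z →
      Disjoint ((r * y) • half e.rev) ((r * z) • half e.rev) := by
    intro y hy z hz hyz
    rw [mul_smul, mul_smul]
    exact disjoint_smul_smul (he.disjoint_smul_half hy hz hyz) r
  refine goldenRatio_le_of_three_maps hS (half_nonempty e.rev) (hsub _ h₁ h₁1) (hsub _ h₂ h₂1)
    (hsub _ h₃ h₃1) (hdis _ h₁ _ h₂ h₁₂) (hdis _ h₁ _ h₃ h₁₃) (hdis _ h₂ _ h₃ h₂₃)
    (hrS.wordLength_mul_le l₁) (hrS.wordLength_mul_le l₂) ?_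
  have h1 := wordLength_mul_le hS r y₃
  have h2 := hrS.wordLength_le
  omega

/-- The three maps are `r * s`, `r * s⁻¹` and `r⁻¹ * s`. -/
theorem goldenRatio_le_of_two_nonInvolutions {K L : Subgroup G} (hK : IsVertexGroup K)
    (hL : IsVertexGroup L) (hne : K ≠ L) {r s : G} (hr : r ∈ L) (hs : s ∈ K) (hr2 : r * r ≠ 1)
    (hs2 : s * s ≠ 1) (lr : IsLetter S r) (ls : IsLetter S s) :
    Real.goldenRatio ≤ expGrowthRate S := by
  obtain ⟨e, he, he'⟩ := hK.exists_separating hL hne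
  have hr1 : r ≠ 1 := fun h => hr2 (by simp [h])
  have hs1 : s ≠ 1 := fun h => hs2 (by simp [h])
  have hsub : ∀ y ∈ K, y ≠ 1 → ∀ x ∈ L, x ≠ 1 → (x * y) • half e.rev ⊆ x • half e ∧
      (x * y) • half e.rev ⊆ half e.rev := by
    intro y hy hy1 x hx hx1
    rw [mul_smul]
    have h1 := he'.smul_half_subset hx hx1
    rw [rev_rev] at h1
    have h2 := Set.smul_set_mono (a := x) (he.smul_half_subset hy hy1)
    exact ⟨h2, h2.trans h1⟩
  have hK1 := hsub s hs hs1 r hr hr1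
  have hK2 := hsub s⁻¹ (inv_mem hs) (inv_ne_one.2 hs1) r hr hr1
  have hK3 := hsub s hs hs1 r⁻¹ (inv_mem hr) (inv_ne_one.2 hr1)
  have hd := he'.disjoint_smul_half hr (inv_mem hr) (fun h => hr2 (eq_inv_iff_mul_eq_one.1 h))
  rw [rev_rev] at hd
  refine goldenRatio_le_of_three_maps hS (half_nonempty e.rev) (α := r * s) (β := r * s⁻¹)
    (γ := r⁻¹ * s) hK1.2 hK2.2 hK3.2 ?_ (hd.mono hK1.1 hK3.1) (hd.mono hK2.1 hK3.1)
    (lr.wordLength_mul_le ls) (lr.wordLength_mul_le ls.inv)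
    ((lr.inv.wordLength_mul_le ls).trans (by omega))
  rw [mul_smul, mul_smul]
  exact disjoint_smul_smul
    (he.disjoint_smul_half hs (inv_mem hs) (fun h => hs2 (eq_inv_iff_mul_eq_one.1 h))) r

omit hS in
theorem rev_le_of_pointsTo {K L M : Subgroup G} (hK : IsVertexGroup K) (hL : IsVertexGroup L)
    (hM : IsVertexGroup M) {e f : OrientedEdge G} (heK : PointsTo K e) (heL : PointsTo L e.rev)
    (heM : PointsTo M e.rev) (hfK : PointsTo K f.rev) (hfL : PointsTo L f)
    (hfM : PointsTo M f.rev) : e.rev ≤ f := by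
  rcases trichotomy e f with h | h | h | h | h | h
  · exact (hK.not_pointsTo_rev heK (h ▸ hfK)).elim
  · rw [h, rev_rev]
  · exact (hL.not_pointsTo_rev (hfL.of_le h.le) heL).elim
  · exact (hK.not_pointsTo_rev (heK.of_le h.le) hfK).elim
  · exact (hM.not_pointsTo_rev (hfM.of_le h.le) heM).elim
  · exact h.le

/-- The half-trees beyond `e`, `f`, `g` are pairwise disjoint, and each of `a`, `b`, `c` maps the
other two into its own. The three maps are `a * b`, `a * c` and `a * b * c` on the half-tree beyond
`e`. -/
theorem goldenRatio_le_of_tripod {K L M : Subgroup G} (hK : IsVertexGroup K)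
    (hL : IsVertexGroup L) (hM : IsVertexGroup M) {a b c : G} (ha : a ∈ K) (hb : b ∈ L)
    (hc : c ∈ M) (ha1 : a ≠ 1) (hb1 : b ≠ 1) (hc1 : c ≠ 1) (la : IsLetter S a)
    (lb : IsLetter S b) (lc : IsLetter S c) {e f g : OrientedEdge G}
    (heK : PointsTo K e) (heL : PointsTo L e.rev) (heM : PointsTo M e.rev)
    (hfK : PointsTo K f.rev) (hfL : PointsTo L f) (hfM : PointsTo M f.rev)
    (hgK : PointsTo K g.rev) (hgL : PointsTo L g.rev) (hgM : PointsTo M g) :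
    Real.goldenRatio ≤ expGrowthRate S := by
  have hef := rev_le_of_pointsTo hK hL hM heK heL heM hfK hfL hfM
  have heg := rev_le_of_pointsTo hK hM hL heK heM heL hgK hgM hgL
  have hfg := rev_le_of_pointsTo hL hM hK hfL hfM hfK hgL hgM hgK
  have swap : ∀ {x y : OrientedEdge G}, x.rev ≤ y → y.rev ≤ x := fun {x y} h => by
    rwa [← rev_le_rev, rev_rev]
  have aQ : a • half f ⊆ half e :=
    (Set.smul_set_mono (half_anti hef)).trans (heK.smul_half_subset ha ha1)
  have aR : a • half g ⊆ half e :=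
    (Set.smul_set_mono (half_anti heg)).trans (heK.smul_half_subset ha ha1)
  have bP : b • half e ⊆ half f :=
    (Set.smul_set_mono (half_anti (swap hef))).trans (hfL.smul_half_subset hb hb1)
  have bR : b • half g ⊆ half f :=
    (Set.smul_set_mono (half_anti hfg)).trans (hfL.smul_half_subset hb hb1)
  have cP : c • half e ⊆ half g :=
    (Set.smul_set_mono (half_anti (swap heg))).trans (hgM.smul_half_subset hc hc1)
  have bcP : b • c • half e ⊆ half f := (Set.smul_set_mono cP).trans bR
  refine goldenRatio_le_of_three_maps hS (half_nonempty e) (α := a * b) (β := a * c)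
    (γ := a * b * c) ?_ ?_ ?_ ?_ ?_ ?_ (la.wordLength_mul_le lb) (la.wordLength_mul_le lc)
    (la.wordLength_mul_mul_le lb lc) <;> simp only [mul_smul]
  · exact (Set.smul_set_mono bP).trans aQ
  · exact (Set.smul_set_mono cP).trans aR
  · exact (Set.smul_set_mono bcP).trans aQ
  · exact disjoint_smul_smul ((disjoint_half hfg).mono bP cP) a
  · exact disjoint_smul_smul (disjoint_smul_smul ((disjoint_half heg).mono_right cP) b) a
  · exact disjoint_smul_smul ((disjoint_half hfg).symm.mono cP bcP) a

omit hS in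
/-- The vertex of `L` lies between those of `K` and `M`. -/
theorem IsVertexGroup.exists_edges_of_between {K L M : Subgroup G} (hK : IsVertexGroup K)
    (hL : IsVertexGroup L) (hM : IsVertexGroup M) (hKL : K ≠ L) (hLM : L ≠ M)
    (hbet : ∀ e, PointsTo L e → PointsTo K e ∨ PointsTo M e) :
    ∃ e f, PointsTo K e ∧ PointsTo L e.rev ∧ PointsTo L f ∧ PointsTo M f.rev ∧ f < e := by
  obtain ⟨e, heK, heL⟩ := hK.exists_separating hL hKL
  obtain ⟨f, hfL, hfM⟩ := hL.exists_separating hM hLM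
  have heM : PointsTo M e.rev := (hbet _ heL).resolve_left (hK.not_pointsTo_rev heK)
  have hfK : PointsTo K f :=
    (hbet _ hfL).resolve_right fun h => hM.not_pointsTo_rev h hfM
  refine ⟨e, f, heK, heL, hfL, hfM, ?_⟩
  rcases trichotomy e f with h | h | h | h | h | h
  · exact (hL.not_pointsTo_rev hfL (h ▸ heL)).elim
  · exact (hK.not_pointsTo_rev hfK (h ▸ heK)).elim
  · exact (hL.not_pointsTo_rev (hfL.of_le h.le) heL).elim
  · exact h
  · exact (hM.not_pointsTo_rev (hfM.of_le h.le) heM).elim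
  · exact (hK.not_pointsTo_rev hfK (heK.of_le (rev_lt.1 h).le)).elim

-- Elements that fix different vertices have a hyperbolic product, whose axis runs through every
-- edge separating the vertices.
omit hS in
theorem PointsTo.mem_axis_mul {K L : Subgroup G} {e : OrientedEdge G} (heK : PointsTo K e)
    (heL : PointsTo L e.rev) {x y : G} (hx : x ∈ K) (hy : y ∈ L) (hx1 : x ≠ 1) (hy1 : y ≠ 1) :
    e ∈ axis (x * y) := by
  have h1 := heL y hy hy1
  rw [smul_rev, rev_rev, ← smul_lt_smul (g := x), smul_rev] at h1
  rw [mem_axis, mul_smul]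
  exact (heK x hx hx1).trans h1

-- Near the vertex of `L`, the axis of `x * y` passes from `y⁻¹ • e.rev` to `e`, and that of `y⁻¹ *
-- z` from `f` to `y⁻¹ • f.rev`. The mixed inequalities come from `f < e` and its reversed image
-- under `y⁻¹`.
omit hS in
theorem coherent_of_between {K L M : Subgroup G} {x y z : G} (hx : x ∈ K) (hy : y ∈ L)
    (hz : z ∈ M) (hx1 : x ≠ 1) (hy1 : y ≠ 1) (hz1 : z ≠ 1) {e f : OrientedEdge G}
    (heK : PointsTo K e) (heL : PointsTo L e.rev) (hfL : PointsTo L f) (hfM : PointsTo M f.rev)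
    (hfe : f < e) : Coherent (x * y) (y⁻¹ * z) (y⁻¹ • e.rev) f := by
  have h1 : y⁻¹ • e.rev < e := by
    have := heL y⁻¹ (inv_mem hy) (inv_ne_one.2 hy1)
    rw [smul_rev, rev_rev] at this
    rw [smul_rev]
    exact rev_lt.1 this
  have h2 : e < (x * y) • y⁻¹ • e.rev := by
    rw [smul_smul, mul_inv_cancel_right]
    exact heK x hx hx1
  have h3 : y⁻¹ • f.rev < (y⁻¹ * z) • f := by
    rw [mul_smul, smul_lt_smul]
    simpa [smul_rev] using hfM z hz hz1
  have h4 : f < y⁻¹ • f.rev := hfL y⁻¹ (inv_mem hy) (inv_ne_one.2 hy1)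
  exact ⟨h1.trans h2, (smul_lt_smul.2 (rev_lt_rev.2 hfe)).trans h3, hfe.trans h2, h4.trans h3⟩

/-- Ping-pong of the inverses is covered as well: `z⁻¹ * y` and `y⁻¹ * x⁻¹` have the same shape. -/
theorem goldenRatio_le_or_axis_eq {x y z : G} (lx : IsLetter S x) (ly : IsLetter S y)
    (lz : IsLetter S z) {e f : OrientedEdge G} (hc : Coherent (x * y) (y⁻¹ * z) e f) :
    Real.goldenRatio ≤ expGrowthRate S ∨ axis (x * y) = axis (y⁻¹ * z) := by
  by_cases h1 : PingPong (x * y) (y⁻¹ * z)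
  · exact Or.inl (h1.goldenRatio_le_of_mul hS lx ly lz)
  by_cases h2 : PingPong (x * y)⁻¹ (y⁻¹ * z)⁻¹
  · have h3 := h2.symm
    rw [mul_inv_rev, mul_inv_rev, inv_inv] at h3
    exact Or.inl (h3.goldenRatio_le_of_mul hS lz.inv ly lx.inv)
  · exact Or.inr ((hc.axis_subset h1 h2).antisymm
      (hc.symm.axis_subset (fun h => h1 h.symm) fun h => h2 h.symm))

/-- On a common axis, `f` would be comparable with both `y⁻¹ • e.rev` and `y • e.rev`. These
approach the vertex of `L` by different branches, as `y * y ≠ 1`. -/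
theorem goldenRatio_le_of_between_middle {K L M : Subgroup G} (hK : IsVertexGroup K)
    (hL : IsVertexGroup L) (hM : IsVertexGroup M) (hKL : K ≠ L) (hLM : L ≠ M)
    (hbet : ∀ e, PointsTo L e → PointsTo K e ∨ PointsTo M e) {x y z : G} (hx : x ∈ K)
    (hy : y ∈ L) (hz : z ∈ M) (hx1 : x ≠ 1) (hz1 : z ≠ 1) (hy2 : y * y ≠ 1) (lx : IsLetter S x)
    (ly : IsLetter S y) (lz : IsLetter S z) : Real.goldenRatio ≤ expGrowthRate S := by
  have hy1 : y ≠ 1 := fun h => hy2 (by simp [h])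
  obtain ⟨e, f, heK, heL, hfL, hfM, hfe⟩ := hK.exists_edges_of_between hL hM hKL hLM hbet
  have hc := coherent_of_between hx hy hz hx1 hy1 hz1 heK heL hfL hfM hfe
  refine (goldenRatio_le_or_axis_eq hS lx ly lz hc).resolve_right fun heq => ?_
  have hA : y⁻¹ • e.rev ∈ axis (y⁻¹ * z) := heq ▸ hc.left
  have he : e ∈ axis (y⁻¹ * z) := heq ▸ heK.mem_axis_mul heL hx hy hx1 hy1
  have hf : f ∈ axis (y⁻¹ * z) := hc.right
  have hf' : y⁻¹ • f.rev ∈ axis (y⁻¹ * z) := by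
    have h1 : y⁻¹ • f.rev < (y⁻¹ * z) • f := by
      rw [mul_smul, smul_lt_smul]
      simpa [smul_rev] using hfM z hz hz1
    exact h1.trans (smul_lt_smul.2 (hfL y⁻¹ (inv_mem hy) (inv_ne_one.2 hy1)))
  have hyA : (y * y) • y⁻¹ • e.rev = y • e.rev := by rw [smul_smul, mul_inv_cancel_right]
  have hAB : y⁻¹ • e.rev < (y • e.rev).rev := by
    have := (heL.smul (inv_mem hy)) (y * y) (mul_mem hy hy) hy2
    rwa [hyA] at this
  have hBf : y • e.rev ≤ f ∨ f ≤ y • e.rev := by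
    have hrev : ∀ {p q : OrientedEdge G}, p ≤ y⁻¹ • q.rev ↔ q ≤ y • p.rev := by
      intro p q
      rw [← smul_le_smul (g := y), smul_inv_smul, ← rev_le_rev, rev_rev, smul_rev]
    have hrev' : ∀ {p q : OrientedEdge G}, y⁻¹ • q.rev ≤ p ↔ y • p.rev ≤ q := by
      intro p q
      rw [← smul_le_smul (g := y), smul_inv_smul, ← rev_le_rev, rev_rev, smul_rev]
    rcases lt_or_ge_of_mem_axis he hf' with h | h
    · exact Or.inr (hrev.1 h.le)
    · exact Or.inl (hrev'.1 h)
  rcases lt_or_ge_of_mem_axis hA hf with h | h <;> rcases hBf with h' | h'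
  · refine not_le_and_le_rev (c := y • e.rev) (e := (y * y) • f) ?_
      (h'.trans (hfL _ (mul_mem hy hy) hy2).le)
    rw [← hyA, smul_le_smul]
    exact h.le
  · exact not_le_and_le_rev (h.le.trans h') hAB.le
  · exact not_le_rev _ (h'.trans (h.trans hAB.le))
  · exact not_le_and_le_rev h' (h.trans hAB.le)

omit hS in
theorem preservesAxis_of_conj_eq_inv {u s : G} (h : s * u * s⁻¹ = u⁻¹) : PreservesAxis u s :=
  preservesAxis_of_forall fun e he => by
    have := smul_mem_axis_conj s he
    rw [h, mem_axis_inv] at this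
    exact Or.inr this

omit hS in
theorem preservesAxis_inv {u s : G} (h : PreservesAxis u s) : PreservesAxis u⁻¹ s := by
  intro e he
  rw [mem_axis_inv, mem_axis_inv, rev_rev] at *
  exact (h e he.symm).symm

/-- The involution `y` reverses the axis of `x * y`. If this is also the axis of `y⁻¹ * z`, it
contains `y • z • f` and, after reflection, `y • z⁻¹ • f`; but `z • f` and `z⁻¹ • f` diverge at the
vertex of `M`, as `z * z ≠ 1`. -/
theorem goldenRatio_le_of_between_end {K L M : Subgroup G} (hK : IsVertexGroup K)
    (hL : IsVertexGroup L) (hM : IsVertexGroup M) (hKL : K ≠ L) (hLM : L ≠ M)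
    (hbet : ∀ e, PointsTo L e → PointsTo K e ∨ PointsTo M e) {x y z : G} (hx : x ∈ K)
    (hy : y ∈ L) (hz : z ∈ M) (hx1 : x ≠ 1) (hy1 : y ≠ 1) (hx2 : x * x = 1) (hy2 : y * y = 1)
    (hz2 : z * z ≠ 1) (lx : IsLetter S x)
    (ly : IsLetter S y) (lz : IsLetter S z) : Real.goldenRatio ≤ expGrowthRate S := by
  have hz1 : z ≠ 1 := fun h => hz2 (by simp [h])
  have hyi : y⁻¹ = y := inv_eq_of_mul_eq_one_left hy2
  have hxi : x⁻¹ = x := inv_eq_of_mul_eq_one_left hx2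
  obtain ⟨e, f, heK, heL, hfL, hfM, hfe⟩ := hK.exists_edges_of_between hL hM hKL hLM hbet
  have hc := coherent_of_between hx hy hz hx1 hy1 hz1 heK heL hfL hfM hfe
  refine (goldenRatio_le_or_axis_eq hS lx ly lz hc).resolve_right fun heq => ?_
  have hf : f ∈ axis (y⁻¹ * z) := hc.right
  have h1 : y • z • f ∈ axis (x * y) := by
    have := pow_smul_mem_axis hf 1
    rwa [pow_one, ← heq, mul_smul, hyi] at this
  have h2 : z⁻¹ • f.rev ∈ axis (x * y) := by
    rw [heq, mem_axis, smul_smul, mul_inv_cancel_right]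
    have h3 := hfM z⁻¹ (inv_mem hz) (inv_ne_one.2 hz1)
    rw [smul_rev, rev_rev, rev_lt] at h3
    exact h3.trans (hfL y⁻¹ (inv_mem hy) (inv_ne_one.2 hy1))
  have h3 : y • z⁻¹ • f ∈ axis (x * y) := by
    have h4 := smul_mem_axis_conj y h2
    have h5 : y * (x * y) * y⁻¹ = (x * y)⁻¹ := by
      rw [mul_inv_rev, hyi, hxi, mul_assoc, mul_assoc, hy2, mul_one]
    rwa [h5, mem_axis_inv, smul_rev, smul_rev, rev_rev] at h4
  have h4 : (z • f).rev < z⁻¹ • f := by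
    have h5 := (hfM.smul hz) (z⁻¹ * z⁻¹) (mul_mem (inv_mem hz) (inv_mem hz)) fun h0 => hz2 (by
      rw [← mul_inv_rev, inv_eq_one] at h0
      exact h0)
    rwa [smul_smul, inv_mul_cancel_right, smul_rev, smul_rev, rev_rev] at h5
  rcases lt_or_ge_of_mem_axis h1 h3 with h | h
  · exact not_le_and_rev_le (smul_lt_smul.1 h).le h4.le
  · exact not_rev_le _ (h4.le.trans (smul_le_smul.1 h))

theorem goldenRatio_le_or_of_between_involutions {K L M : Subgroup G} (hK : IsVertexGroup K)
    (hL : IsVertexGroup L) (hM : IsVertexGroup M) (hKL : K ≠ L) (hLM : L ≠ M)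
    (hbet : ∀ e, PointsTo L e → PointsTo K e ∨ PointsTo M e) {x y z : G} (hx : x ∈ K)
    (hy : y ∈ L) (hz : z ∈ M) (hx1 : x ≠ 1) (hy1 : y ≠ 1) (hz1 : z ≠ 1)
    (hy2 : y * y = 1) (hz2 : z * z = 1) (lx : IsLetter S x)
    (ly : IsLetter S y) (lz : IsLetter S z) :
    Real.goldenRatio ≤ expGrowthRate S ∨
      ((axis (x * y)).Nonempty ∧ axis (x * y) = axis (y * z) ∧
        PreservesAxis (y * z) y ∧ PreservesAxis (y * z) z) := by
  have hyi : y⁻¹ = y := inv_eq_of_mul_eq_one_left hy2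
  have hzi : z⁻¹ = z := inv_eq_of_mul_eq_one_left hz2
  obtain ⟨e, f, heK, heL, hfL, hfM, hfe⟩ := hK.exists_edges_of_between hL hM hKL hLM hbet
  have hc := coherent_of_between hx hy hz hx1 hy1 hz1 heK heL hfL hfM hfe
  refine (goldenRatio_le_or_axis_eq hS lx ly lz hc).imp_right fun heq => ?_
  rw [hyi] at heq
  refine ⟨⟨_, hc.left⟩, heq, preservesAxis_of_conj_eq_inv ?_, preservesAxis_of_conj_eq_inv ?_⟩
  · rw [mul_inv_rev, hyi, hzi, ← mul_assoc y, hy2, one_mul]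
  · rw [mul_inv_rev, hyi, hzi, mul_assoc, mul_assoc, hz2, mul_one]

/-- Three vertices span a tripod, or one of them lies between the other two. -/
theorem goldenRatio_le_or_between {K L M : Subgroup G} (hK : IsVertexGroup K)
    (hL : IsVertexGroup L) (hM : IsVertexGroup M) {a b c : G} (ha : a ∈ K) (hb : b ∈ L)
    (hc : c ∈ M) (ha1 : a ≠ 1) (hb1 : b ≠ 1) (hc1 : c ≠ 1) (la : IsLetter S a)
    (lb : IsLetter S b) (lc : IsLetter S c) :
    Real.goldenRatio ≤ expGrowthRate S ∨
      (∀ e, PointsTo K e → PointsTo L e ∨ PointsTo M e) ∨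
      (∀ e, PointsTo L e → PointsTo K e ∨ PointsTo M e) ∨
      (∀ e, PointsTo M e → PointsTo K e ∨ PointsTo L e) := by
  by_contra! h
  obtain ⟨h0, ⟨e, he, he1, he2⟩, ⟨f, hf, hf1, hf2⟩, ⟨g, hg, hg1, hg2⟩⟩ := h
  refine h0.not_ge (goldenRatio_le_of_tripod hS hK hL hM ha hb hc ha1 hb1 hc1 la lb lc he
    ((hL.pointsTo_or e).resolve_left he1) ((hM.pointsTo_or e).resolve_left he2)
    ((hK.pointsTo_or f).resolve_left hf1) hf ((hM.pointsTo_or f).resolve_left hf2)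
    ((hK.pointsTo_or g).resolve_left hg1) ((hL.pointsTo_or g).resolve_left hg2) hg)

theorem goldenRatio_le_of_order_two_two_three {K L M : Subgroup G} (hK : IsVertexGroup K)
    (hL : IsVertexGroup L) (hM : IsVertexGroup M) (hKL : K ≠ L) (hKM : K ≠ M) (hLM : L ≠ M)
    {a b c : G} (ha : a ∈ K) (hb : b ∈ L)
    (hc : c ∈ M) (ha1 : a ≠ 1) (hb1 : b ≠ 1) (ha2 : a * a = 1) (hb2 : b * b = 1)
    (hc2 : c * c ≠ 1) (la : IsLetter S a) (lb : IsLetter S b) (lc : IsLetter S c) :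
    Real.goldenRatio ≤ expGrowthRate S := by
  have hc1 : c ≠ 1 := fun h => hc2 (by simp [h])
  rcases goldenRatio_le_or_between hS hK hL hM ha hb hc ha1 hb1 hc1 la lb lc with h | h | h | h
  · exact h
  · exact goldenRatio_le_of_between_end hS hL hK hM hKL.symm hKM h hb ha hc hb1 ha1 hb2 ha2 hc2
      lb la lc
  · exact goldenRatio_le_of_between_end hS hK hL hM hKL hLM h ha hb hc ha1 hb1 ha2 hb2 hc2 la lb lc
  · exact goldenRatio_le_of_between_middle hS hK hM hL hKM hLM.symm h ha hc hb ha1 hb1 hc2 la lc lb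

theorem goldenRatio_le_or_preservesAxis {K L M : Subgroup G} (hK : IsVertexGroup K)
    (hL : IsVertexGroup L) (hM : IsVertexGroup M) (hKL : K ≠ L) (hKM : K ≠ M) (hLM : L ≠ M)
    {a b c : G} (ha : a ∈ K) (hb : b ∈ L)
    (hc : c ∈ M) (ha1 : a ≠ 1) (hb1 : b ≠ 1) (hc1 : c ≠ 1) (ha2 : a * a = 1) (hb2 : b * b = 1)
    (hc2 : c * c = 1) (la : IsLetter S a) (lb : IsLetter S b) (lc : IsLetter S c) :
    Real.goldenRatio ≤ expGrowthRate S ∨ PreservesAxis (a * b) c := by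
  rcases goldenRatio_le_or_between hS hK hL hM ha hb hc ha1 hb1 hc1 la lb lc with h | h | h | h
  · exact Or.inl h
  · refine (goldenRatio_le_or_of_between_involutions hS hL hK hM hKL.symm hKM h hb ha hc hb1 ha1
      hc1 ha2 hc2 lb la lc).imp_right fun ⟨_, heq, _, h2⟩ => ?_
    have h3 : PreservesAxis (b * a) c := by rw [PreservesAxis, heq]; exact h2
    have h4 := preservesAxis_inv h3
    rwa [mul_inv_rev, inv_eq_of_mul_eq_one_left ha2, inv_eq_of_mul_eq_one_left hb2] at h4
  · refine (goldenRatio_le_or_of_between_involutions hS hK hL hM hKL hLM h ha hb hc ha1 hb1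
      hc1 hb2 hc2 la lb lc).imp_right fun ⟨_, heq, _, h2⟩ => ?_
    rw [PreservesAxis, heq]
    exact h2
  · refine (goldenRatio_le_or_of_between_involutions hS hK hM hL hKM hLM.symm h ha hc hb ha1 hc1
      hb1 hc2 hb2 la lc lb).imp_right fun ⟨⟨m, hm⟩, heq, h1, _⟩ => ?_
    -- Here `c` is in the middle and `a * b = (a * c) * (c * b)` is a product of two translations
    -- along the same axis in the same direction.
    have hsub : axis (a * c) ⊆ axis (a * b) := by
      intro e he
      have hab : a * b = (a * c) * (c * b) := by
        rw [mul_assoc, ← mul_assoc c, hc2, one_mul]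
      have he' : e ∈ axis (c * b) := heq ▸ he
      have he2 := pow_smul_mem_axis he' 1
      rw [pow_one, ← heq] at he2
      rw [mem_axis, hab, mul_smul]
      exact lt_trans he' he2
    rw [PreservesAxis, (axis_subset_of_subset hm hsub).antisymm hsub, heq]
    exact h1

/-- The growth rate of a free product is at least the golden ratio, unless both factors have order
two or the group is generated by elements of orders two and three playing ping-pong. -/
theorem goldenRatio_le_or_of_freeSplitting :
    Real.goldenRatio ≤ expGrowthRate S ∨
      (∀ i, ∀ k ∈ factor (G := G) i, ∀ l ∈ factor (G := G) i, k ≠ 1 → l ≠ 1 → k = l) ∨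
      ∃ (a c : G) (e : OrientedEdge G), a ≠ 1 ∧ a * a = 1 ∧ c ≠ 1 ∧ c * c = c⁻¹ ∧
        Subgroup.closure {a, c} = ⊤ ∧ e < (a • e).rev ∧ e.rev < c • e ∧ e.rev < c⁻¹ • e := by
  by_cases hhyp : ∃ h, IsLetter S h ∧ (axis h).Nonempty
  · obtain ⟨h, hh, e, he⟩ := hhyp
    exact (goldenRatio_le_of_mem_axis hS hh he).imp_right Or.inl
  push Not at hhyp
  have hV : ∀ s, IsLetter S s → s ≠ 1 → ∃ K : Subgroup G, IsVertexGroup K ∧ s ∈ K :=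
    fun s hs hs1 => exists_isVertexGroup_of_axis_eq_empty hs1 (hhyp s hs)
  choose! K hK hmem using hV
  have other : ∀ L : Subgroup G, IsVertexGroup L → ∃ r, IsLetter S r ∧ r ≠ 1 ∧ r ∉ L := by
    intro L hL
    by_contra! h
    refine hL.ne_top (top_le_iff.1 ?_)
    rw [← hS, Subgroup.closure_le]
    intro s hs
    by_cases hs1 : s = 1
    · rw [hs1]; exact one_mem L
    · exact h s (Or.inl hs) hs1
  rw [or_iff_not_imp_left]
  intro hφ
  -- Otherwise `s`, `t` and `s * t` are three elements of one vertex group.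
  have same : ∀ s t, IsLetter S s → IsLetter S t → s ≠ 1 → t ≠ 1 → K s = K t →
      t = s ∨ t = s⁻¹ := by
    intro s t ls lt hs1 ht1 hst
    by_contra! h
    obtain ⟨r, lr, hr1, hr⟩ := other _ (hK s ls hs1)
    have hsK := hmem s ls hs1
    have htK : t ∈ K s := hst ▸ hmem t lt ht1
    exact hφ (goldenRatio_le_of_three_mem hS (hK s ls hs1) (hK r lr hr1)
      (fun h0 => hr (h0 ▸ hmem r lr hr1)) (hmem r lr hr1) hr1 lr hsK htK (mul_mem hsK htK) hs1 ht1
      (fun h0 => h.2 (eq_inv_of_mul_eq_one_right h0)) h.1.symm (by simpa using ht1)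
      (by simpa using hs1) ls lt (ls.wordLength_mul_le lt))
  -- Otherwise `s`, `s⁻¹` and `s * s` are such a triple.
  have order : ∀ s, IsLetter S s → s ≠ 1 → s * s = 1 ∨ s * s = s⁻¹ := by
    intro s ls hs1
    by_contra! h
    obtain ⟨r, lr, hr1, hr⟩ := other _ (hK s ls hs1)
    have hsK := hmem s ls hs1
    exact hφ (goldenRatio_le_of_three_mem hS (hK s ls hs1) (hK r lr hr1)
      (fun h0 => hr (h0 ▸ hmem r lr hr1)) (hmem r lr hr1) hr1 lr hsK (inv_mem hsK)
      (mul_mem hsK hsK) hs1 (inv_ne_one.2 hs1) h.1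
      (fun h0 => h.1 (eq_inv_iff_mul_eq_one.1 h0)) (by simpa using hs1) h.2.symm ls ls.inv
      (ls.wordLength_mul_le ls))
  have mixed : ∀ s t, IsLetter S s → IsLetter S t → s ≠ 1 → t ≠ 1 → K s ≠ K t →
      t * t ≠ 1 → s * s = 1 := by
    intro s t ls lt hs1 ht1 hst ht2
    by_contra h
    exact hφ (goldenRatio_le_of_two_nonInvolutions hS (hK s ls hs1) (hK t lt ht1) hst
      (hmem t lt ht1) (hmem s ls hs1) ht2 h lt ls)
  by_cases hinv : ∀ s, IsLetter S s → s ≠ 1 → s * s = 1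
  · left
    have inj : ∀ s t, IsLetter S s → IsLetter S t → s ≠ 1 → t ≠ 1 → t ≠ s → K s ≠ K t := by
      intro s t ls lt hs1 ht1 hts h
      have := same s t ls lt hs1 ht1 h
      rw [inv_eq_of_mul_eq_one_left (hinv s ls hs1), or_self] at this
      exact hts this
    obtain ⟨a, la, ha1, -⟩ := other _ (isVertexGroup_factor true)
    obtain ⟨b, lb, hb1, hb⟩ := other _ (hK a la ha1)
    have hab : b ≠ a := fun h => hb (h ▸ hmem a la ha1)
    obtain ⟨e, he, he'⟩ := (hK a la ha1).exists_separating (hK b lb hb1) (inj a b la lb ha1 hb1 hab)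
    have hax := he.mem_axis_mul he' (hmem a la ha1) (hmem b lb hb1) ha1 hb1
    have hai := inv_eq_of_mul_eq_one_left (hinv a la ha1)
    have hbi := inv_eq_of_mul_eq_one_left (hinv b lb hb1)
    -- With all letters involutions, each of them preserves the axis of `a * b`, so the tree is a
    -- line.
    refine fun i k hk l hl hk1 hl1 => factor_subsingleton_of_preservesAxis hS hax ?_ i hk hl hk1 hl1
    intro c lc
    rcases eq_or_ne c 1 with rfl | hc1
    · exact fun e he => by simpa using he
    rcases eq_or_ne c a with rfl | hca
    · refine preservesAxis_of_conj_eq_inv ?_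
      rw [mul_inv_rev, hai, hbi, ← mul_assoc c, hinv c la ha1, one_mul]
    rcases eq_or_ne c b with rfl | hcb
    · refine preservesAxis_of_conj_eq_inv ?_
      rw [mul_inv_rev, hai, hbi, mul_assoc, mul_assoc, hinv c lb hb1, mul_one]
    exact (goldenRatio_le_or_preservesAxis hS (hK a la ha1) (hK b lb hb1) (hK c lc hc1)
      (inj a b la lb ha1 hb1 hab) (inj a c la lc ha1 hc1 hca) (inj b c lb lc hb1 hc1 hcb)
      (hmem a la ha1) (hmem b lb hb1) (hmem c lc hc1) ha1 hb1 hc1 (hinv a la ha1) (hinv b lb hb1)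
      (hinv c lc hc1) la lb lc).resolve_left hφ
  · right
    push Not at hinv
    obtain ⟨c, lc, hc1, hc2⟩ := hinv
    obtain ⟨a, la, ha1, ha⟩ := other _ (hK c lc hc1)
    have hac : K a ≠ K c := fun h => ha (h ▸ hmem a la ha1)
    have ha2 := mixed a c la lc ha1 hc1 hac hc2
    -- A further letter would fix a third vertex and be an involution: orders two, two, three at
    -- different vertices.
    have hgen : ∀ s, IsLetter S s → s ≠ 1 → s = a ∨ s = c ∨ s = c⁻¹ := by
      intro b lb hb1
      by_contra! h
      have hbc : K b ≠ K c := fun h0 => by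
        rcases same c b lc lb hc1 hb1 h0.symm with h1 | h1
        exacts [h.2.1 h1, h.2.2 h1]
      have hab : K a ≠ K b := fun h0 => by
        have := same a b la lb ha1 hb1 h0
        rw [inv_eq_of_mul_eq_one_left ha2, or_self] at this
        exact h.1 this
      exact hφ (goldenRatio_le_of_order_two_two_three hS (hK a la ha1) (hK b lb hb1) (hK c lc hc1)
        hab hac hbc (hmem a la ha1) (hmem b lb hb1) (hmem c lc hc1) ha1 hb1 ha2
        (mixed b c lb lc hb1 hc1 hbc hc2) hc2 la lb lc)
    obtain ⟨e, he, he'⟩ := (hK a la ha1).exists_separating (hK c lc hc1) hac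
    have hec := he' c (hmem c lc hc1) hc1
    have hec' := he' c⁻¹ (inv_mem (hmem c lc hc1)) (inv_ne_one.2 hc1)
    rw [smul_rev, rev_rev] at hec hec'
    refine ⟨a, c, e, ha1, ha2, hc1, (order c lc hc1).resolve_left hc2, ?_,
      he a (hmem a la ha1) ha1, hec, hec'⟩
    rw [← top_le_iff, ← hS, Subgroup.closure_le]
    intro s hs
    have hcmem : c ∈ Subgroup.closure {a, c} := Subgroup.subset_closure (by simp)
    by_cases hs1 : s = 1
    · rw [hs1]; exact one_mem (Subgroup.closure {a, c})
    rcases hgen s (Or.inl hs) hs1 with h | h | h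
    · rw [h]; exact Subgroup.subset_closure (by simp)
    · rw [h]; exact hcmem
    · rw [h]; exact inv_mem hcmem

end Letters

end FreeSplitting

open Monoid

/-! ### The splitting of a free product -/

universe u v

/-- The two-element family of groups `A`, `B`. -/
def GroupPair (A B : Type u) : Bool → Type u := fun b => bif b then A else B

instance {A B : Type u} [Group A] [Group B] : ∀ b, Group (GroupPair A B b)
  | true => inferInstanceAs (Group A)
  | false => inferInstanceAs (Group B)

theorem GroupPair.nontrivial {A B : Type u} [Nontrivial A] [Nontrivial B] :
    ∀ b, Nontrivial (GroupPair A B b)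
  | true => inferInstanceAs (Nontrivial A)
  | false => inferInstanceAs (Nontrivial B)

/-- A family of homomorphisms on `GroupPair A B`. -/
def GroupPair.homs {A B : Type u} {P : Type*} [Group A] [Group B] [Group P] (f : A →* P) (g : B →* P) :
    ∀ b, GroupPair A B b →* P
  | true => f
  | false => g

/-- The binary free product as an indexed free product. -/
def coprodEquivCoprodI (A B : Type u) [Group A] [Group B] :
    Coprod A B ≃* CoprodI (GroupPair A B) :=
  MonoidHom.toMulEquiv
    (Coprod.lift (CoprodI.of (M := GroupPair A B) (i := true))
      (CoprodI.of (M := GroupPair A B) (i := false)))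
    (CoprodI.lift (GroupPair.homs (P := Coprod A B) Coprod.inl Coprod.inr))
    (by
      apply Coprod.hom_ext <;> ext x
      · exact CoprodI.lift_of (GroupPair.homs (P := Coprod A B) Coprod.inl Coprod.inr) (i := true) x
      · exact CoprodI.lift_of (GroupPair.homs (P := Coprod A B) Coprod.inl Coprod.inr) (i := false) x)
    (by
      apply CoprodI.ext_hom
      rintro (_ | _) <;> ext x <;>
        simp only [MonoidHom.comp_apply, CoprodI.lift_of, GroupPair.homs, MonoidHom.id_apply]
      · exact Coprod.lift_apply_inr _ _ x
      · exact Coprod.lift_apply_inl _ _ x)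

theorem coprodEquivCoprodI_inl {A B : Type u} [Group A] [Group B] (x : A) :
    coprodEquivCoprodI A B (Coprod.inl x) = CoprodI.of (M := GroupPair A B) (i := true) x :=
  Coprod.lift_apply_inl (CoprodI.of (M := GroupPair A B) (i := true))
    (CoprodI.of (M := GroupPair A B) (i := false)) x

theorem coprodEquivCoprodI_inr {A B : Type u} [Group A] [Group B] (x : B) :
    coprodEquivCoprodI A B (Coprod.inr x) = CoprodI.of (M := GroupPair A B) (i := false) x :=
  Coprod.lift_apply_inr (CoprodI.of (M := GroupPair A B) (i := true))
    (CoprodI.of (M := GroupPair A B) (i := false)) x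

theorem lift_eq_coprodI_lift {A B : Type u} {P : Type*} [Group A] [Group B] [Group P] (f : A →* P)
    (g : B →* P) (x : Coprod A B) :
    Coprod.lift f g x = CoprodI.lift (GroupPair.homs f g) (coprodEquivCoprodI A B x) := by
  have : Coprod.lift f g =
      (CoprodI.lift (GroupPair.homs f g)).comp (coprodEquivCoprodI A B).toMonoidHom := by
    apply Coprod.hom_ext <;> ext x
    · change Coprod.lift f g (Coprod.inl x) =
        CoprodI.lift (GroupPair.homs f g) (coprodEquivCoprodI A B (Coprod.inl x))
      rw [Coprod.lift_apply_inl, coprodEquivCoprodI_inl]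
      exact (CoprodI.lift_of (GroupPair.homs f g) (i := true) x).symm
    · change Coprod.lift f g (Coprod.inr x) =
        CoprodI.lift (GroupPair.homs f g) (coprodEquivCoprodI A B (Coprod.inr x))
      rw [Coprod.lift_apply_inr, coprodEquivCoprodI_inr]
      exact (CoprodI.lift_of (GroupPair.homs f g) (i := false) x).symm
  rw [this]
  rfl

section Normal

open CoprodI

variable {M : Bool → Type*} [∀ b, Group (M b)]

open Classical in
/-- The factor that contains the first syllable. -/
noncomputable def firstFactor (g : CoprodI M) : Option Bool := (Word.equiv g).fstIdx

open Classical in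
/-- The number of syllables. -/
noncomputable def syllableLength (g : CoprodI M) : ℕ := (Word.equiv g).toList.length

theorem firstFactor_prod (w : Word M) : firstFactor w.prod = w.fstIdx := by
  classical
  rw [firstFactor]
  congr 1
  exact Word.equiv.apply_symm_apply w

theorem syllableLength_prod (w : Word M) : syllableLength w.prod = w.toList.length := by
  classical
  rw [syllableLength]
  congr 2
  exact Word.equiv.apply_symm_apply w

theorem firstFactor_neWord {i j : Bool} (w : NeWord M i j) : firstFactor w.prod = some i := by
  rw [NeWord.prod, firstFactor_prod, Word.fstIdx]
  change Option.map Sigma.fst w.toList.head? = some i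
  rw [NeWord.toList_head?]
  rfl

theorem syllableLength_neWord {i j : Bool} (w : NeWord M i j) :
    syllableLength w.prod = w.toList.length := by
  rw [NeWord.prod, syllableLength_prod]
  rfl

@[simp]
theorem firstFactor_one : firstFactor (1 : CoprodI M) = none := by
  rw [← Word.prod_empty, firstFactor_prod]
  rfl

@[simp]
theorem syllableLength_one : syllableLength (1 : CoprodI M) = 0 := by
  rw [← Word.prod_empty, syllableLength_prod]
  rfl

theorem exists_neWord {g : CoprodI M} (hg : g ≠ 1) :
    ∃ (i j : Bool) (w : NeWord M i j), w.prod = g := by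
  classical
  obtain ⟨i, j, w, hw⟩ := NeWord.of_word (Word.equiv g) fun h => hg (by
    rw [← Word.equiv.symm_apply_apply g, h]
    exact Word.prod_empty)
  exact ⟨i, j, w, by rw [NeWord.prod, hw]; exact Word.equiv.symm_apply_apply g⟩

/-- The splitting of an indexed free product of two nontrivial groups. -/
noncomputable abbrev coprodIFreeSplitting (hM : ∀ b, Nontrivial (M b)) :
    FreeSplitting (CoprodI M) where
  side := firstFactor
  len := syllableLength
  factor i := (CoprodI.of (M := M) (i := i)).range
  side_eq_none g := by
    constructor
    · intro h
      by_contra hg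
      obtain ⟨i, j, w, rfl⟩ := exists_neWord hg
      rw [firstFactor_neWord] at h
      simp at h
    · rintro rfl
      exact firstFactor_one
  side_mul g h hg hgh := by
    rcases eq_or_ne h 1 with rfl | hh
    · rw [mul_one]
    obtain ⟨i, j, w, rfl⟩ := exists_neWord hg
    obtain ⟨k, l, v, rfl⟩ := exists_neWord hh
    rw [← NeWord.inv_prod, firstFactor_neWord, firstFactor_neWord, ne_eq, Option.some.injEq] at hgh
    rw [← NeWord.append_prod (hne := hgh), firstFactor_neWord, firstFactor_neWord]
  len_mul g h hgh := by
    rcases eq_or_ne g 1 with rfl | hg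
    · simp
    rcases eq_or_ne h 1 with rfl | hh
    · simp
    obtain ⟨i, j, w, rfl⟩ := exists_neWord hg
    obtain ⟨k, l, v, rfl⟩ := exists_neWord hh
    rw [← NeWord.inv_prod, firstFactor_neWord, firstFactor_neWord, ne_eq, Option.some.injEq] at hgh
    rw [← NeWord.append_prod (hne := hgh), syllableLength_neWord, syllableLength_neWord,
      syllableLength_neWord, NeWord.toList, List.length_append]
  len_pos g hg := by
    obtain ⟨i, j, w, rfl⟩ := exists_neWord hg
    rw [syllableLength_neWord, List.length_pos_iff]
    exact w.toList_ne_nil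
  side_of_mem := by
    rintro i _ ⟨x, rfl⟩ hx
    have hx1 : x ≠ 1 := fun h => hx (by rw [h, map_one])
    rw [← NeWord.prod_singleton x hx1, firstFactor_neWord]
  len_of_mem := by
    rintro i _ ⟨x, rfl⟩ hx
    have hx1 : x ≠ 1 := fun h => hx (by rw [h, map_one])
    rw [← NeWord.prod_singleton x hx1, syllableLength_neWord]
    rfl
  exists_factor g i hg := by
    classical
    have hprod : (Word.equiv g).prod = g := Word.equiv.symm_apply_apply g
    rw [← hprod] at hg ⊢
    generalize Word.equiv g = w at hg
    rw [firstFactor_prod] at hg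
    induction w using Word.consRecOn with
    | empty => simp [Word.fstIdx, Word.empty] at hg
    | cons k m w hmw hm1 _ =>
      rw [Word.fstIdx_cons, Option.some.injEq] at hg
      subst hg
      refine ⟨CoprodI.of m, ⟨m, rfl⟩, fun h => hm1 ?_, w.prod, Word.prod_cons _ _ _ _ _, ?_⟩
      · exact CoprodI.of_injective k (h.trans (map_one _).symm)
      · rwa [firstFactor_prod]
  factor_nontrivial i := by
    obtain ⟨x, hx⟩ := @exists_ne _ (hM i) (1 : M i)
    exact ⟨CoprodI.of x, ⟨x, rfl⟩, fun h =>
      hx (CoprodI.of_injective i (h.trans (map_one _).symm))⟩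

end Normal

/-- Transport of a splitting along an isomorphism. -/
abbrev FreeSplitting.comap {G H : Type*} [Group G] [Group H] (F : FreeSplitting H) (e : G ≃* H) :
    FreeSplitting G where
  side g := F.side (e g)
  len g := F.len (e g)
  factor i := (F.factor i).comap e.toMonoidHom
  side_eq_none g := by rw [F.side_eq_none, EmbeddingLike.map_eq_one_iff]
  side_mul g h hg hgh := by
    rw [map_mul]
    exact F.side_mul _ _ (by simpa using hg) (by simpa using hgh)
  len_mul g h hgh := by
    rw [map_mul]
    exact F.len_mul _ _ (by simpa using hgh)
  len_pos g hg := F.len_pos _ (by simpa using hg)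
  side_of_mem i g hg hg1 := F.side_of_mem i _ hg (by simpa using hg1)
  len_of_mem i g hg hg1 := F.len_of_mem i _ hg (by simpa using hg1)
  exists_factor g i hg := by
    obtain ⟨a, ha, ha1, h, hah, hh⟩ := F.exists_factor _ i hg
    refine ⟨e.symm a, by simpa using ha, by simpa using ha1, e.symm h, ?_, by simpa using hh⟩
    rw [← map_mul, ← hah, e.symm_apply_apply]
  factor_nontrivial i := by
    obtain ⟨a, ha, ha1⟩ := F.factor_nontrivial i
    exact ⟨e.symm a, by simpa using ha, by simpa using ha1⟩

/-- The identification of a free product with an indexed free product in one universe. -/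
noncomputable def coprodEquivCoprodIULift (A : Type u) (B : Type v) [Group A] [Group B] :
    Coprod A B ≃* CoprodI (GroupPair (ULift.{v} A) (ULift.{u} B)) :=
  (MulEquiv.coprodCongr MulEquiv.ulift.symm MulEquiv.ulift.symm).trans (coprodEquivCoprodI _ _)

noncomputable instance Monoid.Coprod.freeSplitting {A : Type u} {B : Type v} [Group A] [Group B]
    [Nontrivial A] [Nontrivial B] : FreeSplitting (Coprod A B) :=
  (coprodIFreeSplitting GroupPair.nontrivial).comap (coprodEquivCoprodIULift A B)

theorem inl_mem_factor {A : Type u} {B : Type v} [Group A] [Group B] [Nontrivial A] [Nontrivial B] (x : A) :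
    (Coprod.inl x : Coprod A B) ∈ FreeSplitting.factor true := by
  refine ⟨(ULift.up x : ULift.{v} A), ?_⟩
  change _ = coprodEquivCoprodI (ULift.{v} A) (ULift.{u} B) (MulEquiv.coprodCongr
    MulEquiv.ulift.symm MulEquiv.ulift.symm (Coprod.inl x))
  exact (coprodEquivCoprodI_inl (A := ULift.{v} A) (B := ULift.{u} B) (ULift.up x)).symm

theorem inr_mem_factor {A : Type u} {B : Type v} [Group A] [Group B] [Nontrivial A] [Nontrivial B] (x : B) :
    (Coprod.inr x : Coprod A B) ∈ FreeSplitting.factor false := by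
  refine ⟨(ULift.up x : ULift.{u} B), ?_⟩
  change _ = coprodEquivCoprodI (ULift.{v} A) (ULift.{u} B) (MulEquiv.coprodCongr
    MulEquiv.ulift.symm MulEquiv.ulift.symm (Coprod.inr x))
  exact (coprodEquivCoprodI_inr (A := ULift.{v} A) (B := ULift.{u} B) (ULift.up x)).symm

/-! ### The exceptional free products -/

theorem nonempty_mulEquiv_zmod_two {A : Type*} [Group A] [Nontrivial A]
    (h : ∀ x y : A, x ≠ 1 → y ≠ 1 → x = y) : Nonempty (A ≃* Multiplicative (ZMod 2)) := by
  have : Fact (Nat.Prime 2) := ⟨Nat.prime_two⟩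
  have hA : Nat.card A = 2 := by
    rw [Nat.card_eq_two_iff' (1 : A)]
    obtain ⟨x, hx⟩ := exists_ne (1 : A)
    exact ⟨x, hx, fun y hy => h y x hy hx⟩
  exact ⟨mulEquivOfPrimeCardEq hA (by simp)⟩

open scoped Pointwise in
/-- Subgroups of orders two and three that play ping-pong generate their free product. -/
theorem nonempty_mulEquiv_of_pingPong {G : Type*} [Group G] {a c : G} (ha1 : a ≠ 1)
    (ha2 : a * a = 1) (hc1 : c ≠ 1) (hc3 : c * c = c⁻¹) (hgen : Subgroup.closure {a, c} = ⊤)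
    {X Y : Set G} (hX : X.Nonempty) (hY : Y.Nonempty) (hXY : Disjoint X Y) (ha : a • Y ⊆ X)
    (hc : c • X ⊆ Y) (hc' : c⁻¹ • X ⊆ Y) :
    Nonempty (G ≃* Coprod (Multiplicative (ZMod 2)) (Multiplicative (ZMod 3))) := by
  have : Fact (Nat.Prime 2) := ⟨Nat.prime_two⟩
  have : Fact (Nat.Prime 3) := ⟨Nat.prime_three⟩
  have oa : orderOf a = 2 := orderOf_eq_prime (by rw [pow_two, ha2]) ha1
  have hc3' : c ^ 3 = 1 := by rw [pow_succ, pow_two, hc3, inv_mul_cancel]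
  have oc : orderOf c = 3 := orderOf_eq_prime hc3' hc1
  have memA : ∀ x ∈ Subgroup.zpowers a, x ≠ 1 → x = a := by
    rintro _ ⟨k, rfl⟩ hk
    rcases Int.even_or_odd' k with ⟨m, rfl | rfl⟩
    · refine (hk ?_).elim
      change a ^ (2 * m) = 1
      rw [zpow_mul, zpow_two, ha2, one_zpow]
    · change a ^ (2 * m + 1) = a
      rw [zpow_add_one, zpow_mul, zpow_two, ha2, one_zpow, one_mul]
  have memC : ∀ x ∈ Subgroup.zpowers c, x ≠ 1 → x = c ∨ x = c⁻¹ := by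
    rintro _ ⟨k, rfl⟩ hk
    have hk' : c ^ k = c ^ (k % 3) := by
      conv_lhs => rw [← Int.emod_add_mul_ediv k 3, zpow_add, zpow_mul]
      rw [show c ^ (3 : ℤ) = 1 by exact_mod_cast hc3', one_zpow, mul_one]
    have h3 : k % 3 = 0 ∨ k % 3 = 1 ∨ k % 3 = 2 := by omega
    change c ^ k ≠ 1 at hk
    change c ^ k = c ∨ c ^ k = c⁻¹
    rcases h3 with h | h | h <;> rw [h] at hk'
    · exact (hk (by rw [hk', zpow_zero])).elim
    · exact Or.inl (by rw [hk', zpow_one])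
    · exact Or.inr (by rw [hk', zpow_two, hc3])
  let f := Coprod.lift (Subgroup.zpowers a).subtype (Subgroup.zpowers c).subtype
  have hinj : Function.Injective f := by
    have key : Function.Injective (CoprodI.lift (GroupPair.homs (Subgroup.zpowers a).subtype
        (Subgroup.zpowers c).subtype)) := by
      -- Ping-pong with only two groups needs one of them to have at least three elements; here it
      -- is the group generated by `c`.
      refine CoprodI.lift_injective_of_ping_pong _ (Or.inr ⟨false, ?_⟩)
        (fun b => bif b then X else Y) ?_ ?_ ?_
      · change (3 : Cardinal) ≤ Cardinal.mk (Subgroup.zpowers c)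
        have hcard : Nat.card (Subgroup.zpowers c) = 3 := by rw [Nat.card_zpowers, oc]
        have : Finite (Subgroup.zpowers c) := Nat.finite_of_card_ne_zero (by omega)
        rw [← Nat.cast_card, hcard]
        simp
      · rintro (_ | _)
        · exact hY
        · exact hX
      · rintro (_ | _) (_ | _) h
        · exact (h rfl).elim
        · exact hXY.symm
        · exact hXY
        · exact (h rfl).elim
      · rintro (_ | _) (_ | _) hij h h1
        · exact (hij rfl).elim
        · have h2 := memC h.1 h.2 (fun h0 => h1 (Subtype.ext h0))
          change h.1 • X ⊆ Y
          rcases h2 with h2 | h2 <;> rw [h2]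
          · exact hc
          · exact hc'
        · have h2 := memA h.1 h.2 (fun h0 => h1 (Subtype.ext h0))
          change h.1 • Y ⊆ X
          rw [h2]
          exact ha
        · exact (hij rfl).elim
    have : (f : Coprod _ _ → G) = CoprodI.lift (GroupPair.homs (Subgroup.zpowers a).subtype
        (Subgroup.zpowers c).subtype) ∘ coprodEquivCoprodI _ _ :=
      funext fun x => lift_eq_coprodI_lift _ _ x
    rw [this]
    exact key.comp (coprodEquivCoprodI _ _).injective
  have hsurj : Function.Surjective f := by
    rw [← MonoidHom.range_eq_top, Coprod.range_lift, Subgroup.range_subtype,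
      Subgroup.range_subtype, ← top_le_iff, ← hgen, Subgroup.closure_le]
    rintro x (rfl | rfl)
    · exact Subgroup.mem_sup_left (Subgroup.mem_zpowers x)
    · exact Subgroup.mem_sup_right (Subgroup.mem_zpowers x)
  have eA : Subgroup.zpowers a ≃* Multiplicative (ZMod 2) :=
    mulEquivOfPrimeCardEq (p := 2) (by rw [Nat.card_zpowers, oa]) (by simp)
  have eC : Subgroup.zpowers c ≃* Multiplicative (ZMod 3) :=
    mulEquivOfPrimeCardEq (p := 3) (by rw [Nat.card_zpowers, oc]) (by simp)
  exact ⟨(MulEquiv.ofBijective f ⟨hinj, hsurj⟩).symm.trans (MulEquiv.coprodCongr eA eC)⟩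

theorem goldenRatio_le_expGrowthRate_coprod {A B : Type*} [Group A] [Group B] [Nontrivial A]
    [Nontrivial B]
    (h2 : IsEmpty (Coprod A B ≃* Coprod (Multiplicative (ZMod 2)) (Multiplicative (ZMod 2))))
    (h3 : IsEmpty (Coprod A B ≃* Coprod (Multiplicative (ZMod 2)) (Multiplicative (ZMod 3))))
    {S : Finset (Coprod A B)} (hS : Subgroup.closure (S : Set (Coprod A B)) = ⊤) :
    Real.goldenRatio ≤ expGrowthRate S := by
  rcases FreeSplitting.goldenRatio_le_or_of_freeSplitting hS with
    h | h | ⟨a, c, e, ha1, ha2, hc1, hc3, hgen, hea, hec, hec'⟩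
  · exact h
  · obtain ⟨eA⟩ := nonempty_mulEquiv_zmod_two (A := A) fun x y hx hy =>
      Coprod.inl_injective (N := B) (h true _ (inl_mem_factor x) _ (inl_mem_factor y)
        (by rwa [ne_eq, map_eq_one_iff _ Coprod.inl_injective])
        (by rwa [ne_eq, map_eq_one_iff _ Coprod.inl_injective]))
    obtain ⟨eB⟩ := nonempty_mulEquiv_zmod_two (A := B) fun x y hx hy =>
      Coprod.inr_injective (M := A) (h false _ (inr_mem_factor x) _ (inr_mem_factor y)
        (by rwa [ne_eq, map_eq_one_iff _ Coprod.inr_injective])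
        (by rwa [ne_eq, map_eq_one_iff _ Coprod.inr_injective]))
    exact (h2.false (MulEquiv.coprodCongr eA eB)).elim
  · obtain ⟨E⟩ := nonempty_mulEquiv_of_pingPong ha1 ha2 hc1 hc3 hgen
      (FreeSplitting.half_nonempty e) (FreeSplitting.half_nonempty e.rev)
      (FreeSplitting.disjoint_half_rev e)
      (by rw [FreeSplitting.smul_half]; exact FreeSplitting.half_anti hea.le)
      (by rw [FreeSplitting.smul_half]; exact FreeSplitting.half_anti hec.le)
      (by rw [FreeSplitting.smul_half]; exact FreeSplitting.half_anti hec'.le)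
    exact (h3.false E).elim

/-! ### The minimal growth rate, the exceptional groups and the theorem -/

theorem expGrowthRate_nonneg {G : Type*} [Group G] {S : Finset G}
    (hS : Subgroup.closure (S : Set G) = ⊤) : 0 ≤ expGrowthRate S :=
  ge_of_tendsto' (tendsto_expGrowthRate hS) fun n => by positivity

theorem minExpGrowthRate_le {G : Type*} [Group G] {S : Finset G}
    (hS : Subgroup.closure (S : Set G) = ⊤) : minExpGrowthRate G ≤ expGrowthRate S :=
  csInf_le ⟨0, by rintro _ ⟨T, hT, rfl⟩; exact expGrowthRate_nonneg hT⟩ ⟨S, hS, rfl⟩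

theorem map_mem_zpowers_ofAdd_one {n : ℕ} [NeZero n] {G : Type*} [Group G]
    (f : Multiplicative (ZMod n) →* G) (x : Multiplicative (ZMod n)) :
    f x ∈ Subgroup.zpowers (f (Multiplicative.ofAdd 1)) := by
  refine ⟨(x.toAdd.val : ℤ), ?_⟩
  change f _ ^ (x.toAdd.val : ℤ) = f x
  rw [zpow_natCast, ← map_pow, ← ofAdd_nsmul]
  simp

theorem minExpGrowthRate_le_sqrt_two {G : Type*} [Group G] {n : ℕ} [NeZero n]
    (hn : n = 2 ∨ n = 3)
    (e : G ≃* Coprod (Multiplicative (ZMod 2)) (Multiplicative (ZMod n))) :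
    minExpGrowthRate G ≤ √2 := by
  classical
  let f : Multiplicative (ZMod 2) →* G := e.symm.toMonoidHom.comp Coprod.inl
  let g : Multiplicative (ZMod n) →* G := e.symm.toMonoidHom.comp Coprod.inr
  let S : Finset G := {f (Multiplicative.ofAdd 1), g (Multiplicative.ofAdd 1)}
  have hf : f (Multiplicative.ofAdd 1) ∈ Subgroup.closure (S : Set G) :=
    Subgroup.subset_closure (by simp [S])
  have hg : g (Multiplicative.ofAdd 1) ∈ Subgroup.closure (S : Set G) :=
    Subgroup.subset_closure (by simp [S])
  have hS : Subgroup.closure (S : Set G) = ⊤ := by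
    have h1 : Subgroup.map e.symm.toMonoidHom ⊤ = ⊤ :=
      Subgroup.map_top_of_surjective _ e.symm.surjective
    rw [← top_le_iff, ← h1, ← Coprod.range_inl_sup_range_inr, Subgroup.map_sup,
      MonoidHom.map_range, MonoidHom.map_range, sup_le_iff]
    constructor
    · rintro _ ⟨x, rfl⟩
      exact (Subgroup.zpowers_le.2 hf) (map_mem_zpowers_ofAdd_one f x)
    · rintro _ ⟨x, rfl⟩
      exact (Subgroup.zpowers_le.2 hg) (map_mem_zpowers_ofAdd_one g x)
  refine (minExpGrowthRate_le hS).trans (expGrowthRate_le_sqrt_two hS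
    (a := f (Multiplicative.ofAdd 1)) (b := g (Multiplicative.ofAdd 1)) (by simp [S]) ?_ ?_)
  · rw [← map_mul, ← map_one f]
    rfl
  · rcases hn with rfl | rfl
    · left
      rw [← map_mul, ← map_one g]
      rfl
    · right
      rw [← map_mul, ← map_inv]
      rfl

theorem theorem1 {A B : Type*} [Group A] [Group B] [Nontrivial A] [Nontrivial B]
    (hfg : Group.FG (Monoid.Coprod A B)) :
    (IsEmpty (Monoid.Coprod A B ≃*
        Monoid.Coprod (Multiplicative (ZMod 2)) (Multiplicative (ZMod 2))) →
      IsEmpty (Monoid.Coprod A B ≃*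
        Monoid.Coprod (Multiplicative (ZMod 2)) (Multiplicative (ZMod 3))) →
      (1 + Real.sqrt 5) / 2 ≤ minExpGrowthRate (Monoid.Coprod A B)) ∧
    ¬ (Real.sqrt 2 < minExpGrowthRate (Monoid.Coprod A B) ∧
      minExpGrowthRate (Monoid.Coprod A B) < (1 + Real.sqrt 5) / 2) := by

  have main : IsEmpty (Monoid.Coprod A B ≃*
        Monoid.Coprod (Multiplicative (ZMod 2)) (Multiplicative (ZMod 2))) →
      IsEmpty (Monoid.Coprod A B ≃*
        Monoid.Coprod (Multiplicative (ZMod 2)) (Multiplicative (ZMod 3))) →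
      (1 + Real.sqrt 5) / 2 ≤ minExpGrowthRate (Monoid.Coprod A B) := by
    intro h2 h3
    -- Finite generation makes the infimum range over a nonempty set; the real infimum of the empty
    -- set would be 0.
    obtain ⟨-, T, -, hT⟩ := Group.fg_iff'.1 hfg
    refine le_csInf ⟨_, T, hT, rfl⟩ ?_
    rintro _ ⟨S, hS, rfl⟩
    exact goldenRatio_le_expGrowthRate_coprod h2 h3 hS
  refine ⟨main, fun ⟨hlow, hup⟩ => hup.not_ge (main ⟨fun e => ?_⟩ ⟨fun e => ?_⟩)⟩
  · exact hlow.not_ge (minExpGrowthRate_le_sqrt_two (Or.inl rfl) e)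
  · exact hlow.not_ge (minExpGrowthRate_le_sqrt_two (Or.inr rfl) e)
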